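/- Let $\Gamma$ be a finite graph with a piecewise $C^2$ map into $\mathbb R^3$: it has vertices $q_1,\dots,q_N$ and finitely many edges, each of which is mapped as a regular arc of class $C^2$ up to its end points, the end points going to the images of the vertices it joins. Loops, multiple edges and vertices of degree two are allowed. For a vertex $q$ of degree $d$ let $T_1,\dots,T_d$ be the unit tangent vectors at $q$ pointing into the edges at $q$ (a loop counts twice), let $\chi_i(e)=-1$ if $\langle e,T_i\rangle\ge 0$ and $\chi_i(e)=+1$ otherwise, and put $$\mathrm{ntc}(q)=\frac14\int_{S^2}\Big[\sum_{i=1}^d\chi_i(e)\Big]^+dA_{S^2}(e),\qquad \mathrm{NTC}(\Gamma)=\sum_{j=1}^N\mathrm{ntc}(q_j)+\int_{\Gamma_{\rm reg}}|\vec k|\,ds,$$ where $\Gamma_{\rm reg}$ is the union of the edges without their end points, $s$ is arc length and $\vec k=d^2x/ds^2$ is the curvature vector. The double $\widetilde\Gamma$ of $\Gamma$ has the same vertices and two copies of each edge. Fix a parameterization $\Gamma'$ of $\widetilde\Gamma$, that is, a map from a closed $1$-manifold, not necessarily connected, onto $\widetilde\Gamma$ that covers each edge of $\widetilde\Gamma$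 once; so over a vertex $q$ of degree $d$ there are $d$ points of $\Gamma'$, each joining two ends at $q$ of edges of $\widetilde\Gamma$, and over an interior point of an edge of $\Gamma$ there are two, one on each copy of the edge. For $e\in S^2$ and $q\in\Gamma$ let $\mathrm{lmax}(e,q)$ and $\mathrm{lmin}(e,q)$ be the numbers of local maxima and of local minima of the height function $\langle e,\cdot\rangle$ along $\Gamma'$ at the points over $q$, let $\mathrm{nlm}(e,q)=\frac12[\mathrm{lmax}(e,q)-\mathrm{lmin}(e,q)]$, and put $$\mu(e)=\sum\{\mathrm{nlm}(e,q)^+ : q\text{ is a vertex of }\Gamma\text{ or a critical point of }\langle e,\cdot\rangle\text{ in the interior of an edge}\}.$$ Then for almost every $e\in S^2$ the height function $\langle e,\cdot\rangle$ has only finitely many critical points in the interiors of the edges (so that $\mu(e)$ is a finite sum), $\mu$ is integrable on $S^2$, and $$\mathrm{NTC}(\Gamma)=\frac12\int_{S^2}\mu(e)\,dA_{S^2}(e).$$ -/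

import Mathlib

open Set MeasureTheory

noncomputable section

namespace SpatialGraph

/-- Euclidean three-space. -/
abbrev R3 : Type := EuclideanSpace ℝ (Fin 3)

/-- The unit sphere of directions. -/
abbrev S2 : Type := Metric.sphere (0 : R3) 1

/-- The area measure of the unit sphere (of total mass `4π`). -/
def area : Measure S2 := (volume : Measure R3).toSphere

/-- The height function in the direction `e`. -/
def height (e : S2) (x : R3) : ℝ := inner ℝ (e : R3) x

end SpatialGraph

open SpatialGraph

/-- A piecewise `C²` graph mapped into `ℝ³`, with vertices `V` and edges `E`. Each edge `a` is a
regular arc of class `C²` up to its end points, parameterized by `[0,1]`; its end points are the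
images of the vertices `endpt a false` (at parameter `0`) and `endpt a true` (at parameter `1`).
Loops and multiple edges are allowed, and vertices of degree two serve as the points where
different `C²` pieces meet. The values of `arc a` outside `[0,1]` are never used. -/
structure PiecewiseC2Graph (V E : Type*) where
  endpt : E → Bool → V
  pos : V → R3
  arc : E → ℝ → R3
  arc_zero : ∀ a, arc a 0 = pos (endpt a false)
  arc_one : ∀ a, arc a 1 = pos (endpt a true)
  contDiffOn : ∀ a, ContDiffOn ℝ 2 (arc a) (Icc 0 1)
  regular : ∀ a, ∀ t ∈ Icc (0 : ℝ) 1, derivWithin (arc a) (Icc 0 1) t ≠ 0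

namespace PiecewiseC2Graph

variable {V E : Type*} (Γ : PiecewiseC2Graph V E)

/-! ### Curvature of the edges -/

/-- The velocity of the edge `a` at parameter `t` (one-sided at the end points). -/
def velocity (a : E) (t : ℝ) : R3 := derivWithin (Γ.arc a) (Icc 0 1) t

/-- The unit tangent vector `dx/ds` of the edge `a`, where `s` is arc length. -/
def unitTangent (a : E) (t : ℝ) : R3 := ‖Γ.velocity a t‖⁻¹ • Γ.velocity a t

/-- The curvature vector `d²x/ds²` of the edge `a`, where `s` is arc length, so that
`d/ds = ‖velocity‖⁻¹ d/dt`. -/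
def curvatureVector (a : E) (t : ℝ) : R3 :=
  ‖Γ.velocity a t‖⁻¹ • derivWithin (Γ.unitTangent a) (Icc 0 1) t

/-- The total curvature `∫ |k| ds` of the edge `a`, with `ds = ‖velocity‖ dt`. -/
def edgeCurvature (a : E) : ℝ :=
  ∫ t in (0 : ℝ)..1, ‖Γ.curvatureVector a t‖ * ‖Γ.velocity a t‖

/-! ### Half-edges and net total curvature -/

/-- The vertex at which a half-edge starts. A half-edge is a pair `(a, b)`: the edge `a` with
its end at parameter `0` (`b = false`) or at parameter `1` (`b = true`). A loop has two half-edges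
at the same vertex, so the degree of `v` is the number of half-edges `h` with `vertexOf h = v`. -/
def vertexOf (h : E × Bool) : V := Γ.endpt h.1 h.2

/-- The unit tangent vector, at the starting vertex of the half-edge, pointing into the edge. -/
def tangentAt (h : E × Bool) : R3 :=
  if h.2 then -Γ.unitTangent h.1 1 else Γ.unitTangent h.1 0

/-- For a unit vector `T`: `-1` on the hemisphere centred at `T`, `+1` on the opposite one. -/
def chi (T : R3) (e : S2) : ℝ := if 0 ≤ inner ℝ (e : R3) T then -1 else 1

open Classical in
/-- The contribution of the vertex `v` to the net total curvature. -/
def ntc [Fintype E] (v : V) : ℝ :=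
  1 / 4 * ∫ e : S2, max (∑ h : E × Bool with Γ.vertexOf h = v, chi (Γ.tangentAt h) e) 0 ∂area

/-- The net total curvature of a piecewise `C²` graph. -/
def NTC [Fintype V] [Fintype E] : ℝ := ∑ v, Γ.ntc v + ∑ a, Γ.edgeCurvature a

/-! ### The double and its parameterizations -/

/-- The double of a graph: the same vertices, and two copies of each edge. -/
def double : PiecewiseC2Graph V (E × Bool) where
  endpt a := Γ.endpt a.1
  pos := Γ.pos
  arc a := Γ.arc a.1
  arc_zero a := Γ.arc_zero a.1
  arc_one a := Γ.arc_one a.1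
  contDiffOn a := Γ.contDiffOn a.1
  regular a := Γ.regular a.1

/-- A parameterization of a graph by a closed one-dimensional manifold, not necessarily connected,
that covers each edge once. The manifold is obtained from disjoint closed intervals, one for each
edge, by gluing their ends in pairs, two ends being glued only if they lie at the same vertex.
`next h` is the half-edge that is glued to `h`: the curve that runs into a vertex along `h`
leaves it along `next h`. -/
structure Parameterization where
  next : E × Bool → E × Bool
  next_next : ∀ h, next (next h) = h
  next_ne : ∀ h, next h ≠ h
  vertexOf_next : ∀ h, Γ.vertexOf (next h) = Γ.vertexOf h

/-- The double of a graph always has a parameterization: one that runs along each edge on one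
copy and returns at once on the other copy. -/
instance : Inhabited Γ.double.Parameterization where
  default :=
    { next := fun h => ((h.1.1, !h.1.2), h.2)
      next_next := by simp
      next_ne := by
        intro h hh
        have := congrArg (fun x => x.1.2) hh
        simp at this
      vertexOf_next := fun _ => rfl }

/-- The half-edge `h` as a path that starts at its vertex at time `0`. -/
def halfEdgePath (h : E × Bool) (t : ℝ) : R3 :=
  if h.2 then Γ.arc h.1 (1 - t) else Γ.arc h.1 t

variable {Γ}

/-- The path of the parameterization that passes, at time `0`, through the point at which the
half-edges `h` (followed for `t ≥ 0`) and `next h` (followed backwards for `t ≤ 0`) are glued. -/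
def Parameterization.pathThrough (P : Γ.Parameterization) (h : E × Bool) (t : ℝ) : R3 :=
  if 0 ≤ t then Γ.halfEdgePath h t else Γ.halfEdgePath (P.next h) (-t)

/-- The number of local maxima of the height along the parameterization at the points over the
vertex `v`. Such a point is an unordered pair of half-edges at `v` which are glued together. -/
def Parameterization.vertexLmax (P : Γ.Parameterization) (e : S2) (v : V) : ℕ :=
  Set.ncard {x : Sym2 (E × Bool) | ∃ h, Γ.vertexOf h = v ∧ x = s(h, P.next h) ∧
    IsLocalMax (fun t => height e (P.pathThrough h t)) 0}

/-- The number of local minima of the height along the parameterization at the points over the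
vertex `v`. -/
def Parameterization.vertexLmin (P : Γ.Parameterization) (e : S2) (v : V) : ℕ :=
  Set.ncard {x : Sym2 (E × Bool) | ∃ h, Γ.vertexOf h = v ∧ x = s(h, P.next h) ∧
    IsLocalMin (fun t => height e (P.pathThrough h t)) 0}

variable (Γ)

/-- The number of local maxima of the height, along a parameterization of the double, at the two
points (one for each copy `c` of the edge) over the interior point of the edge `a` at parameter
`t`. -/
def interiorLmax (e : S2) (a : E) (t : ℝ) : ℕ :=
  Set.ncard {c : Bool | IsLocalMax (fun s => height e (Γ.double.arc (a, c) s)) t}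

/-- The number of local minima of the height, along a parameterization of the double, at the two
points over the interior point of the edge `a` at parameter `t`. -/
def interiorLmin (e : S2) (a : E) (t : ℝ) : ℕ :=
  Set.ncard {c : Bool | IsLocalMin (fun s => height e (Γ.double.arc (a, c) s)) t}

/-! ### Net local maxima and the multiplicity -/

variable {Γ}

/-- The net number of local maxima at the vertex `v`, with respect to a parameterization of the
double. -/
def vertexNlm (P : Γ.double.Parameterization) (e : S2) (v : V) : ℝ :=
  1 / 2 * ((P.vertexLmax e v : ℝ) - (P.vertexLmin e v : ℝ))

variable (Γ)

/-- The net number of local maxima at an interior point of an edge. -/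
def interiorNlm (e : S2) (a : E) (t : ℝ) : ℝ :=
  1 / 2 * ((Γ.interiorLmax e a t : ℝ) - (Γ.interiorLmin e a t : ℝ))

/-- The critical points of the height in the interiors of the edges. -/
def criticalPoints (e : S2) : Set (E × ℝ) :=
  {q | q.2 ∈ Ioo (0 : ℝ) 1 ∧ deriv (fun s => height e (Γ.arc q.1 s)) q.2 = 0}

variable {Γ}

/-- The multiplicity `μ(e)`: the sum of the positive parts of the net numbers of local maxima over
the vertices and the critical points (meaningful when the latter are finite in number). -/
def multiplicity [Fintype V] (P : Γ.double.Parameterization) (e : S2) : ℝ :=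
  ∑ v, max (vertexNlm P e v) 0 + ∑ᶠ q ∈ Γ.criticalPoints e, max (Γ.interiorNlm e q.1 q.2) 0

end PiecewiseC2Graph

end

/-! Both summands of the net total curvature are averages over directions, and for almost every `e`
the multiplicity splits in the same way: half of `[∑ χ]⁺` at each vertex, plus the number of
nondegenerate maxima of the height inside each edge (`multiplicity_ae_eq`).

Vertices. If no tangent at a vertex is orthogonal to `e`, a glued pair of half-edges is a local
maximum, a local minimum or neither according to the signs `χ` of its two tangents, so `∑ χ = 2
(lmax - lmin)` whatever the gluing (`two_mul_lmax_sub_lmin`). Doubling the graph doubles `∑ χ`,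
which makes the net number of local maxima half of the sum over the original graph.

Edges. An integral-geometric formula of Cauchy–Crofton type is needed: the number of peaks of `⟨e,
·⟩` along an edge integrates to twice its total curvature (`lintegral_ncard_heightPeaks`). Peaks are
the parameters where `⟨e, velocity⟩` drops from positive to negative. Sampled at dyadic parameters,
the number of drops is a sum of indicators of lunes, and a lune has area twice the angle between its
two vectors (`area_lune`). Hence the sampled count integrates to twice the length of a spherical
polygon inscribed in the tangent indicatrix. Under refinement the counts increase to the number of
peaks (`dyadicDrops_mono`, `eventually_dyadicDrops_eq`) and the polygon lengths tend to the total
curvature (`tendsto_sum_angle`); monotone convergence equates the limits.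

The counting needs `⟨e, velocity⟩` to have only simple zeros for almost every `e`, which is a Sard
argument (`ae_simple_zeros`). -/

noncomputable section

open scoped ENNReal Pointwise
open Filter Topology

namespace SpatialGraph

/-! ### Areas of great circles and lunes -/

/-- The area of a measurable part of the sphere cut out by a cone. -/
theorem area_preimage_cone {C : Set R3} (hC : MeasurableSet C)
    (hcone : ∀ x : R3, ∀ r : ℝ, 0 < r → (r • x ∈ C ↔ x ∈ C)) :
    area {e : S2 | (e : R3) ∈ C} = 3 * volume (C ∩ Metric.ball 0 1) := by
  have hm : MeasurableSet {e : S2 | (e : R3) ∈ C} := measurable_subtype_coe hC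
  rw [area, Measure.toSphere_apply' _ hm]
  have hd : (Module.finrank ℝ R3 : ℝ≥0∞) = 3 := by simp
  rw [hd]
  congr 1
  -- The area of a subset of the sphere is the dimension times the volume of the open cone over it;
  -- here that cone is the unit-ball part of `C` without the origin, a null set.
  have h1 : Ioo (0 : ℝ) 1 • ((fun e : S2 => (e : R3)) '' {e : S2 | (e : R3) ∈ C}) =
      (C ∩ Metric.ball 0 1) \ {0} := by
    ext x
    simp only [Set.mem_smul, mem_image, mem_ofPred_eq, Set.mem_sdiff, mem_inter_iff,
      mem_ball_zero_iff, mem_singleton_iff]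
    constructor
    · rintro ⟨r, hr, _, ⟨e, he, rfl⟩, rfl⟩
      have hn : ‖(e : R3)‖ = 1 := by simp
      refine ⟨⟨(hcone _ r hr.1).2 he, ?_⟩, ?_⟩
      · rw [norm_smul, hn, mul_one, Real.norm_of_nonneg hr.1.le]; exact hr.2
      · intro h0
        have := congrArg norm h0
        rw [norm_smul, hn, mul_one, Real.norm_of_nonneg hr.1.le, norm_zero] at this
        exact hr.1.ne' this
    · rintro ⟨⟨hx, hx1⟩, hx0⟩
      have hp : 0 < ‖x‖ := norm_pos_iff.2 hx0
      refine ⟨‖x‖, ⟨hp, hx1⟩, ‖x‖⁻¹ • x, ⟨⟨‖x‖⁻¹ • x, ?_⟩, ?_, rfl⟩, ?_⟩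
      · simp [norm_smul, hp.ne']
      · exact (hcone _ _ (inv_pos.2 hp)).2 hx
      · rw [smul_smul, mul_inv_cancel₀ hp.ne', one_smul]
  rw [h1, measure_sdiff_null (measure_singleton _)]

/-- The exceptional directions form a great circle, whose cone is a plane and so has volume zero. -/
theorem ae_inner_ne_zero {w : R3} (hw : w ≠ 0) : ∀ᵐ e : S2 ∂area, inner ℝ (e : R3) w ≠ 0 := by
  rw [ae_iff]
  have hc : IsClosed {x : R3 | inner ℝ x w = 0} := isClosed_eq (by fun_prop) continuous_const
  have := area_preimage_cone (C := {x : R3 | inner ℝ x w = 0}) hc.measurableSet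
    (fun x r hr => by simp [inner_smul_left, hr.ne'])
  simp only [mem_ofPred_eq] at this
  simp only [ne_eq, not_not]
  rw [this]
  have h2 : volume {x : R3 | inner ℝ x w = 0} = 0 := by
    have h3 : {x : R3 | inner ℝ x w = 0} = ((ℝ ∙ w)ᗮ : Submodule ℝ R3) := by
      ext x
      rw [SetLike.mem_coe, Submodule.mem_orthogonal_singleton_iff_inner_left]; rfl
    rw [h3]
    apply Measure.addHaar_submodule
    intro h
    rw [Submodule.orthogonal_eq_top_iff, Submodule.span_singleton_eq_bot] at h
    exact hw h
  rw [measure_inter_null_of_null_left _ h2, mul_zero]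

theorem volume_eq_lintegral_slice {S : Set R3} (hS : MeasurableSet S) :
    volume S = ∫⁻ z : ℝ, volume {p : ℝ × ℝ | (!₂[p.1, p.2, z] : R3) ∈ S} := by
  have h1 := (EuclideanSpace.volume_preserving_symm_measurableEquiv_toLp (Fin 3)).symm
  have h2 := (volume_preserving_piFinSuccAbove (fun _ : Fin 3 => ℝ) 2).symm
  have h3 := ((MeasurePreserving.id (volume : Measure ℝ)).prod
    (volume_preserving_finTwoArrow ℝ).symm)
  have h := (h1.comp h2).comp h3
  rw [← h.measure_preimage hS.nullMeasurableSet, Measure.volume_eq_prod, Measure.prod_apply]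
  · refine lintegral_congr fun z => ?_
    congr 1
    ext p
    simp only [mem_preimage, mem_ofPred_eq]
    convert Iff.rfl using 2
    ext i
    fin_cases i <;> rfl
  · exact h.measurable hS

theorem measurableSet_pos_neg {X : Type*} [TopologicalSpace X] [MeasurableSpace X]
    [OpensMeasurableSpace X] {f g : X → ℝ} (hf : Continuous f) (hg : Continuous g) :
    MeasurableSet {x | 0 < f x ∧ g x < 0} :=
  ((isOpen_lt continuous_const hf).inter (isOpen_lt hg continuous_const)).measurableSet

theorem mul_neg_iff_neg {r x : ℝ} (hr : 0 < r) : r * x < 0 ↔ x < 0 := by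
  rw [← neg_pos, ← mul_neg, mul_pos_iff_of_pos_left hr, neg_pos]

/-- Identifies a planar sector in polar coordinates as an interval of length `θ`. As `θ ≤ π`, it
stays clear of the branch cut at angle `π`. -/
theorem cos_pos_and_cos_sub_neg_iff {θ φ : ℝ} (hθ : θ ∈ Icc 0 Real.pi)
    (hφ : φ ∈ Ioo (-Real.pi) Real.pi) :
    (0 < Real.cos φ ∧ Real.cos (φ - θ) < 0) ↔ φ ∈ Ioo (-(Real.pi / 2)) (θ - Real.pi / 2) := by
  obtain ⟨h0, h1⟩ := hθ
  obtain ⟨h2, h3⟩ := hφ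
  constructor
  · rintro ⟨hc, hs⟩
    have a1 : -(Real.pi / 2) < φ := by
      by_contra! h
      have := Real.cos_nonpos_of_pi_div_two_le_of_le (x := -φ) (by linarith) (by linarith)
      rw [Real.cos_neg] at this
      linarith
    have a2 : φ < Real.pi / 2 := by
      by_contra! h
      have := Real.cos_nonpos_of_pi_div_two_le_of_le h (by linarith)
      linarith
    refine ⟨a1, ?_⟩
    by_contra! h
    have := Real.cos_nonneg_of_neg_pi_div_two_le_of_le (x := φ - θ) (by linarith) (by linarith)
    linarith
  · rintro ⟨h4, h5⟩
    refine ⟨Real.cos_pos_of_mem_Ioo ⟨h4, by linarith⟩, ?_⟩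
    rw [← Real.cos_neg]
    exact Real.cos_neg_of_pi_div_two_lt_of_lt (by linarith) (by linarith)

/-- The area of a planar circular sector. -/
theorem volume_sector {θ R : ℝ} (hθ : θ ∈ Icc 0 Real.pi) (hR : 0 ≤ R) :
    volume {p : ℝ × ℝ | 0 < p.1 ∧ p.1 * Real.cos θ + p.2 * Real.sin θ < 0 ∧
      p.1 ^ 2 + p.2 ^ 2 < R} = ENNReal.ofReal (θ / 2 * R) := by
  -- The parameter `R` is the square of the radius, which avoids square roots when slicing a ball.
  set S := {p : ℝ × ℝ | 0 < p.1 ∧ p.1 * Real.cos θ + p.2 * Real.sin θ < 0 ∧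
      p.1 ^ 2 + p.2 ^ 2 < R}
  have hS : MeasurableSet S := by
    have := (measurableSet_pos_neg (X := ℝ × ℝ) (f := fun p => p.1)
      (g := fun p => p.1 * Real.cos θ + p.2 * Real.sin θ) (by fun_prop) (by fun_prop)).inter
      (isOpen_lt (f := fun p : ℝ × ℝ => p.1 ^ 2 + p.2 ^ 2) (g := fun _ => R) (by fun_prop)
        continuous_const).measurableSet
    convert this using 1
    ext p
    simp [S, and_assoc]
  have hp := Real.pi_pos
  rw [← lintegral_indicator_one hS, ← lintegral_comp_polarCoord_symm]
  have hEq : ∫⁻ p in polarCoord.target, ENNReal.ofReal p.1 • S.indicator 1 (polarCoord.symm p) =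
      ∫⁻ p in Ioo 0 (√R) ×ˢ Ioo (-(Real.pi / 2)) (θ - Real.pi / 2), ENNReal.ofReal p.1 := by
    rw [← lintegral_indicator polarCoord.open_target.measurableSet,
      ← lintegral_indicator (measurableSet_Ioo.prod measurableSet_Ioo)]
    refine lintegral_congr fun p => ?_
    have key : p ∈ polarCoord.target →
        (polarCoord.symm p ∈ S ↔ p ∈ Ioo 0 (√R) ×ˢ Ioo (-(Real.pi / 2)) (θ - Real.pi / 2)) := by
      rintro ⟨h1, h2⟩
      have h1 : 0 < p.1 := h1
      rw [mem_prod, ← cos_pos_and_cos_sub_neg_iff hθ h2]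
      simp only [S, mem_ofPred_eq, polarCoord_symm_apply, Real.cos_sub, mem_Ioo]
      rw [Real.lt_sqrt h1.le]
      have e1 : (p.1 * Real.cos p.2) ^ 2 + (p.1 * Real.sin p.2) ^ 2 = p.1 ^ 2 := by
        linear_combination p.1 ^ 2 * Real.sin_sq_add_cos_sq p.2
      have e2 : p.1 * Real.cos p.2 * Real.cos θ + p.1 * Real.sin p.2 * Real.sin θ =
        p.1 * (Real.cos p.2 * Real.cos θ + Real.sin p.2 * Real.sin θ) := by ring
      rw [e1, e2, mul_pos_iff_of_pos_left h1, mul_neg_iff_neg h1]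
      tauto
    have sub : p ∈ Ioo 0 (√R) ×ˢ Ioo (-(Real.pi / 2)) (θ - Real.pi / 2) →
        p ∈ polarCoord.target := by
      rintro ⟨h1, h2⟩
      exact ⟨h1.1, by linarith [h2.1], by linarith [h2.2, hθ.2]⟩
    by_cases hp : p ∈ polarCoord.target
    · rw [indicator_of_mem hp]
      by_cases hq : p ∈ Ioo 0 (√R) ×ˢ Ioo (-(Real.pi / 2)) (θ - Real.pi / 2)
      · rw [indicator_of_mem hq, indicator_of_mem ((key hp).2 hq)]; simp
      · rw [indicator_of_notMem hq, indicator_of_notMem (fun h => hq ((key hp).1 h))]; simp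
    · rw [indicator_of_notMem hp, indicator_of_notMem (fun h => hp (sub h))]
  rw [hEq, Measure.volume_eq_prod, ← Measure.prod_restrict, lintegral_prod _ (by fun_prop)]
  simp only [lintegral_const, MeasurableSet.univ, Measure.restrict_apply, univ_inter,
    Real.volume_Ioo]
  rw [lintegral_mul_const _ (by fun_prop), ← ofReal_integral_eq_lintegral_ofReal,
    ← integral_Ioc_eq_integral_Ioo, ← intervalIntegral.integral_of_le (Real.sqrt_nonneg R),
    integral_id, ← ENNReal.ofReal_mul (by simpa using div_nonneg (sq_nonneg (√R)) zero_le_two)]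
  · congr 1
    rw [Real.sq_sqrt hR]; ring
  · exact (continuous_id.integrableOn_Icc (a := 0) (b := √R)).mono_set Ioo_subset_Icc_self
  · filter_upwards [ae_restrict_mem measurableSet_Ioo] with x hx using hx.1.le

/-- The slice at height `z` is a sector of angle `θ` and squared radius `1 - z ^ 2`, empty unless
`|z| < 1`; integrating `θ / 2 * (1 - z ^ 2)` over `(-1, 1)` gives `2 / 3 * θ`. -/
theorem volume_standard_lune {θ : ℝ} (hθ : θ ∈ Icc 0 Real.pi) :
    volume ({x : R3 | 0 < x 0 ∧ x 0 * Real.cos θ + x 1 * Real.sin θ < 0} ∩ Metric.ball 0 1) =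
      ENNReal.ofReal (2 / 3 * θ) := by
  have hm : MeasurableSet {x : R3 | 0 < x 0 ∧ x 0 * Real.cos θ + x 1 * Real.sin θ < 0} :=
    measurableSet_pos_neg (by fun_prop) (by fun_prop)
  rw [volume_eq_lintegral_slice (hm.inter Metric.isOpen_ball.measurableSet)]
  have h1 : ∀ z : ℝ, volume {p : ℝ × ℝ | (!₂[p.1, p.2, z] : R3) ∈
      {x : R3 | 0 < x 0 ∧ x 0 * Real.cos θ + x 1 * Real.sin θ < 0} ∩ Metric.ball 0 1} =
      (Ioo (-1 : ℝ) 1).indicator (fun z => ENNReal.ofReal (θ / 2 * (1 - z ^ 2))) z := by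
    intro z
    have h2 : {p : ℝ × ℝ | (!₂[p.1, p.2, z] : R3) ∈
      {x : R3 | 0 < x 0 ∧ x 0 * Real.cos θ + x 1 * Real.sin θ < 0} ∩ Metric.ball 0 1} =
      {p : ℝ × ℝ | 0 < p.1 ∧ p.1 * Real.cos θ + p.2 * Real.sin θ < 0 ∧
      p.1 ^ 2 + p.2 ^ 2 < 1 - z ^ 2} := by
      ext p
      simp only [mem_ofPred_eq, mem_inter_iff, mem_ball_zero_iff, EuclideanSpace.norm_eq,
        Fin.sum_univ_three, Real.norm_eq_abs, sq_abs]
      rw [Real.sqrt_lt' one_pos]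
      simp [lt_sub_iff_add_lt, and_assoc]
    rw [h2]
    by_cases hz : z ∈ Ioo (-1 : ℝ) 1
    · rw [indicator_of_mem hz, volume_sector hθ (by nlinarith [hz.1, hz.2])]
    · rw [indicator_of_notMem hz]
      convert measure_empty (μ := volume)
      ext p
      simp only [mem_ofPred_eq, mem_empty_iff_false, iff_false, not_and, not_lt]
      intro _ _
      have : 1 ≤ z ^ 2 := by
        by_contra! h
        exact hz (abs_lt.1 (by rwa [sq_lt_one_iff_abs_lt_one] at h))
      nlinarith [sq_nonneg p.1, sq_nonneg p.2]
  simp_rw [h1]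
  rw [lintegral_indicator measurableSet_Ioo, ← ofReal_integral_eq_lintegral_ofReal,
    ← integral_Ioc_eq_integral_Ioo, ← intervalIntegral.integral_of_le (by norm_num)]
  · congr 1
    rw [intervalIntegral.integral_const_mul, intervalIntegral.integral_sub (by simp) (by simp)]
    simp
    ring
  · exact (Continuous.integrableOn_Icc (a := -1) (b := 1) (by fun_prop)).mono_set
      Ioo_subset_Icc_self
  · filter_upwards [ae_restrict_mem measurableSet_Ioo] with x hx
    exact mul_nonneg (by linarith [hθ.1]) (by nlinarith [hx.1, hx.2])

/-- An orthonormal basis adapted to two unit vectors. -/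
theorem exists_orthonormalBasis_adapted {a b : R3} (ha : ‖a‖ = 1) (hb : ‖b‖ = 1) :
    ∃ B : OrthonormalBasis (Fin 3) ℝ R3, B 0 = a ∧
      b = Real.cos (InnerProductGeometry.angle a b) • B 0 +
        Real.sin (InnerProductGeometry.angle a b) • B 1 := by
  set θ := InnerProductGeometry.angle a b with hθ
  have hcos : Real.cos θ = inner ℝ a b := by
    rw [hθ, InnerProductGeometry.cos_angle, ha, hb]; simp
  have hsin0 : 0 ≤ Real.sin θ := InnerProductGeometry.sin_angle_nonneg a b
  have hrest : ‖b - Real.cos θ • a‖ ^ 2 = Real.sin θ ^ 2 := by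
    rw [norm_sub_sq_real, norm_smul, ha, hb, inner_smul_right, real_inner_comm, ← hcos,
      mul_one, Real.norm_eq_abs, sq_abs]
    linear_combination - Real.sin_sq_add_cos_sq θ
  have hrest' : ‖b - Real.cos θ • a‖ = Real.sin θ := by
    rwa [sq_eq_sq₀ (norm_nonneg _) hsin0] at hrest
  obtain ⟨w, hw1, hw2, hw3⟩ : ∃ w : R3, ‖w‖ = 1 ∧ inner ℝ a w = 0 ∧
      b = Real.cos θ • a + Real.sin θ • w := by
    -- If `b = ± a` there is no component of `b` orthogonal to `a` to normalize, and any unit vector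
    -- orthogonal to `a` serves.
    by_cases hs : Real.sin θ = 0
    · have hO : Orthonormal ℝ ((({0} : Set (Fin 3))).domRestrict (fun _ : Fin 3 => a)) := by
        constructor
        · intro i; exact ha
        · intro i j hij; exact absurd (Subsingleton.elim i j) hij
      obtain ⟨B, hB⟩ := hO.exists_orthonormalBasis_extension_of_card_eq (by simp)
      have h0 : B 0 = a := hB 0 rfl
      refine ⟨B 1, B.norm_eq_one 1, ?_, ?_⟩
      · rw [← h0]; exact B.inner_eq_zero (by decide)
      · rw [hs, zero_smul, add_zero]
        rw [hs, norm_eq_zero, sub_eq_zero] at hrest'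
        exact hrest'
    · refine ⟨(Real.sin θ)⁻¹ • (b - Real.cos θ • a), ?_, ?_, ?_⟩
      · rw [norm_smul, hrest', norm_inv, Real.norm_of_nonneg hsin0, inv_mul_cancel₀ hs]
      · rw [inner_smul_right, inner_sub_right, inner_smul_right, real_inner_self_eq_norm_sq, ha,
          hcos]
        ring
      · rw [smul_smul, mul_inv_cancel₀ hs, one_smul]; abel
  have hO : Orthonormal ℝ ((({0, 1} : Set (Fin 3))).domRestrict ![a, w, 0]) := by
    constructor
    · rintro ⟨i, rfl | rfl⟩
      · exact ha
      · exact hw1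
    · rintro ⟨i, rfl | rfl⟩ ⟨j, rfl | rfl⟩ hij
      · exact absurd rfl hij
      · exact hw2
      · exact (real_inner_comm _ _).trans hw2
      · exact absurd rfl hij
  obtain ⟨B, hB⟩ := hO.exists_orthonormalBasis_extension_of_card_eq (by simp)
  have h0 : B 0 = a := hB 0 (by simp)
  have h1 : B 1 = w := hB 1 (by simp)
  exact ⟨B, h0, by rw [h0, h1]; exact hw3⟩

/-- The set of directions in which the height changes from positive at `a` to negative at `b`. -/
def lune (a b : R3) : Set S2 := {e | 0 < inner ℝ (e : R3) a ∧ inner ℝ (e : R3) b < 0}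

theorem measurableSet_lune (a b : R3) : MeasurableSet (lune a b) :=
  measurableSet_pos_neg (by fun_prop) (by fun_prop)

/-- Isometric coordinates adapted to `a` and `b` carry the cone over the lune to the standard one,
so the area is `3 * (2 / 3 * θ)`. -/
theorem area_lune_of_norm_eq_one {a b : R3} (ha : ‖a‖ = 1) (hb : ‖b‖ = 1) :
    area (lune a b) = ENNReal.ofReal (2 * InnerProductGeometry.angle a b) := by
  obtain ⟨B, h0, hbB⟩ := exists_orthonormalBasis_adapted ha hb
  set θ := InnerProductGeometry.angle a b
  have hθ : θ ∈ Icc 0 Real.pi :=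
    ⟨InnerProductGeometry.angle_nonneg a b, InnerProductGeometry.angle_le_pi a b⟩
  have hm : MeasurableSet {x : R3 | 0 < inner ℝ x a ∧ inner ℝ x b < 0} :=
    measurableSet_pos_neg (by fun_prop) (by fun_prop)
  have := area_preimage_cone (C := {x : R3 | 0 < inner ℝ x a ∧ inner ℝ x b < 0}) hm
    (fun x r hr => by simp [inner_smul_left, hr, mul_neg_iff_neg])
  have hm' : MeasurableSet {x : R3 | 0 < x 0 ∧ x 0 * Real.cos θ + x 1 * Real.sin θ < 0} :=
    measurableSet_pos_neg (by fun_prop) (by fun_prop)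
  have hpre : {x : R3 | 0 < inner ℝ x a ∧ inner ℝ x b < 0} ∩ Metric.ball 0 1 =
      B.repr ⁻¹' ({x : R3 | 0 < x 0 ∧ x 0 * Real.cos θ + x 1 * Real.sin θ < 0} ∩
        Metric.ball 0 1) := by
    ext x
    have i0 : inner ℝ x a = B.repr x 0 := by
      rw [B.repr_apply_apply, h0, real_inner_comm]
    have i1 : inner ℝ x b = B.repr x 0 * Real.cos θ + B.repr x 1 * Real.sin θ := by
      rw [hbB, inner_add_right, inner_smul_right, inner_smul_right, B.repr_apply_apply,
        B.repr_apply_apply, real_inner_comm, real_inner_comm (B 1)]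
      ring
    simp only [mem_inter_iff, mem_ofPred_eq, mem_preimage, mem_ball_zero_iff,
      LinearIsometryEquiv.norm_map, i0, i1]
  refine this.trans ?_
  rw [hpre, B.measurePreserving_repr.measure_preimage
    (hm'.inter Metric.isOpen_ball.measurableSet).nullMeasurableSet, volume_standard_lune hθ]
  rw [show (3 : ℝ≥0∞) = ENNReal.ofReal 3 by simp, ← ENNReal.ofReal_mul (by norm_num)]
  congr 1
  ring

theorem lune_smul {a b : R3} {r s : ℝ} (hr : 0 < r) (hs : 0 < s) :
    lune (r • a) (s • b) = lune a b := by
  ext e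
  simp [lune, inner_smul_right, hr, hs, mul_neg_iff_neg]

theorem area_lune {a b : R3} (ha : a ≠ 0) (hb : b ≠ 0) :
    area (lune a b) = ENNReal.ofReal (2 * InnerProductGeometry.angle a b) := by
  have ha' := norm_pos_iff.2 ha
  have hb' := norm_pos_iff.2 hb
  rw [← lune_smul (inv_pos.2 ha') (inv_pos.2 hb'), area_lune_of_norm_eq_one,
    InnerProductGeometry.angle_smul_left_of_pos _ _ (inv_pos.2 ha'),
    InnerProductGeometry.angle_smul_right_of_pos _ _ (inv_pos.2 hb')]
  · simp [norm_smul, ha]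
  · simp [norm_smul, hb]

/-! ### Sard's argument: generic directions give simple zeros -/

/-- A map onto the vectors `y` orthogonal to some `v t`, with `t` stored in the `u`-coordinate of
the source. -/
def orthogonalSweep (v : ℝ → R3) (u : R3) (x : R3) : R3 :=
  inner ℝ (v (inner ℝ u x)) u • (x - inner ℝ u x • u) -
    inner ℝ (v (inner ℝ u x)) (x - inner ℝ u x • u) • u

/-- With `t` fixed, the sweep is `w ↦ ⟨v, u⟩ w - ⟨v, w⟩ u` on `u`-orthogonal vectors `w`. Its values
are orthogonal to `v t`, and dividing the `u`-orthogonal part of `y` by `⟨v, u⟩` inverts it. -/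
theorem exists_orthogonalSweep_eq {v : ℝ → R3} {u : R3} (hu : ‖u‖ = 1) {t : ℝ}
    (ht : inner ℝ (v t) u ≠ 0) {y : R3} (hy : inner ℝ y (v t) = 0) :
    ∃ x, inner ℝ u x = t ∧ orthogonalSweep v u x = y := by
  have huu : inner ℝ u u = (1 : ℝ) := by rw [real_inner_self_eq_norm_sq, hu]; norm_num
  have hx : inner ℝ u ((inner ℝ (v t) u)⁻¹ • (y - inner ℝ u y • u) + t • u) = t := by
    rw [inner_add_right, inner_smul_right, inner_sub_right, inner_smul_right, inner_smul_right, huu]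
    ring
  refine ⟨_, hx, ?_⟩
  rw [orthogonalSweep, hx, add_sub_cancel_right, smul_smul, mul_inv_cancel₀ ht, one_smul,
    inner_smul_right, inner_sub_right, inner_smul_right, real_inner_comm y (v t), hy,
    zero_sub, mul_neg, neg_smul, mul_left_comm, inv_mul_cancel₀ ht, mul_one]
  abel

/-- The formula for `F'` is what differentiating the identity `⟨v (⟨u, x⟩), orthogonalSweep v u x⟩ =
0` yields. -/
theorem exists_hasFDerivWithinAt_orthogonalSweep {v : ℝ → R3} {v' u x : R3} {I : Set ℝ}
    (hu : ‖u‖ = 1) (hv : HasDerivWithinAt v v' I (inner ℝ u x)) :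
    ∃ F' : R3 →L[ℝ] R3, HasFDerivWithinAt (orthogonalSweep v u) F' {x | inner ℝ u x ∈ I} x ∧
      ∀ h, inner ℝ (v (inner ℝ u x)) (F' h) = - inner ℝ u h * inner ℝ v' (orthogonalSweep v u x) := by
  have huu : inner ℝ u u = (1 : ℝ) := by rw [real_inner_self_eq_norm_sq, hu]; norm_num
  have hc : HasFDerivWithinAt (fun x : R3 => inner ℝ u x) (innerSL ℝ u) {x | inner ℝ u x ∈ I} x :=
    (innerSL ℝ u).hasFDerivWithinAt
  have hvc := hv.hasFDerivWithinAt.comp x hc (fun _ h => h)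
  have hw : HasFDerivWithinAt (fun x : R3 => x - inner ℝ u x • u)
      (ContinuousLinearMap.id ℝ R3 - (innerSL ℝ u).smulRight u) {x | inner ℝ u x ∈ I} x :=
    (hasFDerivWithinAt_id x _).sub (hc.smul_const u)
  have h1 := ((hvc.inner ℝ (hasFDerivWithinAt_const u x _)).smul hw).sub
    ((hvc.inner ℝ hw).smul_const u)
  refine ⟨_, h1, fun h => ?_⟩
  simp [orthogonalSweep, inner_sub_right, inner_add_right, inner_smul_right, inner_smul_left]
  ring

/-- At such a point the range of the derivative is orthogonal to `v ≠ 0`, so the determinant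
vanishes. Source and target have equal dimension, so first derivatives suffice for the image to be
null. -/
theorem volume_orthogonalSweep_critical {v v' : ℝ → R3} {u : R3} (hu : ‖u‖ = 1) {I : Set ℝ}
    (hv : ∀ t ∈ I, HasDerivWithinAt v (v' t) I t) (h0 : ∀ t ∈ I, v t ≠ 0) :
    volume (orthogonalSweep v u '' {x | inner ℝ u x ∈ I ∧
      inner ℝ (v' (inner ℝ u x)) (orthogonalSweep v u x) = 0}) = 0 := by
  have h1 : ∀ x ∈ {x | inner ℝ u x ∈ I ∧
      inner ℝ (v' (inner ℝ u x)) (orthogonalSweep v u x) = 0},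
      ∃ F' : R3 →L[ℝ] R3, HasFDerivWithinAt (orthogonalSweep v u) F' {x | inner ℝ u x ∈ I ∧
      inner ℝ (v' (inner ℝ u x)) (orthogonalSweep v u x) = 0} x ∧ F'.det = 0 := by
    rintro x ⟨hx, hx'⟩
    obtain ⟨F', hF, hF'⟩ := exists_hasFDerivWithinAt_orthogonalSweep hu (hv _ hx)
    refine ⟨F', hF.mono fun y hy => hy.1, ?_⟩
    by_contra hd
    have hs := (LinearMap.equivOfDetNeZero (F' : R3 →ₗ[ℝ] R3) hd).surjective (v (inner ℝ u x))
    obtain ⟨h, hh⟩ := hs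
    have := hF' h
    have e : F' h = v (inner ℝ u x) := hh
    rw [e, hx', mul_zero, inner_self_eq_zero] at this
    exact h0 _ hx this
  choose! F' hF hdet using h1
  exact addHaar_image_eq_zero_of_det_fderivWithin_eq_zero _ hF hdet

/-- For almost every direction `e`, the height `⟨e, v⟩` of a nowhere vanishing `C¹` curve has only
simple zeros. -/
theorem ae_simple_zeros {v v' : ℝ → R3} {I : Set ℝ} (hI : IsCompact I)
    (hv : ∀ t ∈ I, HasDerivWithinAt v (v' t) I t) (hc : ContinuousOn v' I) (h0 : ∀ t ∈ I, v t ≠ 0) :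
    ∀ᵐ e : S2 ∂area, ∀ t ∈ I, inner ℝ (e : R3) (v t) = 0 → inner ℝ (e : R3) (v' t) ≠ 0 := by
  set C : Set R3 := {y | ∃ t ∈ I, inner ℝ y (v t) = 0 ∧ inner ℝ y (v' t) = 0} with hC
  have hvc : ContinuousOn v I := fun t ht => (hv t ht).continuousWithinAt
  -- Closedness provides measurability; it holds because `C` is the projection of a closed set along
  -- the compact factor `I`.
  have hclosed : IsClosed C := by
    have hK : IsClosed {p : R3 × I | inner ℝ p.1 (v p.2) = 0 ∧ inner ℝ p.1 (v' p.2) = 0} := by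
      have e1 : Continuous fun p : R3 × I => v p.2 :=
        (continuousOn_iff_continuous_domRestrict.1 hvc).comp continuous_snd
      have e2 : Continuous fun p : R3 × I => v' p.2 :=
        (continuousOn_iff_continuous_domRestrict.1 hc).comp continuous_snd
      exact (isClosed_eq (continuous_fst.inner e1) continuous_const).inter
        (isClosed_eq (continuous_fst.inner e2) continuous_const)
    have : CompactSpace I := isCompact_iff_compactSpace.1 hI
    convert isClosedMap_fst_of_compactSpace _ hK using 1
    ext y
    constructor
    · rintro ⟨t, ht, h1, h2⟩
      exact ⟨(y, ⟨t, ht⟩), ⟨h1, h2⟩, rfl⟩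
    · rintro ⟨⟨_, t⟩, ⟨h1, h2⟩, rfl⟩
      exact ⟨t, t.2, h1, h2⟩
  have hnull : volume C = 0 := by
    -- A single `u` may be orthogonal to `v t` for some `t`; since `v t ≠ 0`, at least one of the
    -- three coordinate vectors is not.
    have hsub : C ⊆ ⋃ i : Fin 3, orthogonalSweep v (EuclideanSpace.basisFun (Fin 3) ℝ i) ''
        {x | inner ℝ (EuclideanSpace.basisFun (Fin 3) ℝ i) x ∈ I ∧
        inner ℝ (v' (inner ℝ (EuclideanSpace.basisFun (Fin 3) ℝ i) x))
          (orthogonalSweep v (EuclideanSpace.basisFun (Fin 3) ℝ i) x) = 0} := by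
      rintro y ⟨t, ht, h1, h2⟩
      obtain ⟨i, hi⟩ : ∃ i, inner ℝ (v t) (EuclideanSpace.basisFun (Fin 3) ℝ i) ≠ 0 := by
        by_contra! h
        apply h0 t ht
        ext i
        have := h i
        rw [real_inner_comm, ← OrthonormalBasis.repr_apply_apply] at this
        simpa using this
      obtain ⟨x, hx, hxy⟩ := exists_orthogonalSweep_eq
        ((EuclideanSpace.basisFun (Fin 3) ℝ).norm_eq_one i) hi h1
      refine mem_iUnion.2 ⟨i, x, ⟨?_, ?_⟩, hxy⟩
      · rw [hx]; exact ht
      · rw [hx, hxy, real_inner_comm]; exact h2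
    refine measure_mono_null hsub (measure_iUnion_null fun i => ?_)
    exact volume_orthogonalSweep_critical ((EuclideanSpace.basisFun (Fin 3) ℝ).norm_eq_one i) hv h0
  have ha := area_preimage_cone hclosed.measurableSet (fun x r hr => by
    simp [hC, inner_smul_left, hr.ne'])
  rw [measure_inter_null_of_null_left _ hnull, mul_zero] at ha
  rw [ae_iff]
  refine measure_mono_null (fun e he => ?_) ha
  simp only [mem_ofPred_eq, not_forall, not_not] at he
  obtain ⟨t, ht, h1, h2⟩ := he
  exact ⟨t, ht, h1, h2⟩

/-! ### Counting sign changes by dyadic sampling -/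

theorem eventually_slope_neg {f : ℝ → ℝ} {c x : ℝ} {s : Set ℝ} (h : HasDerivWithinAt f c s x)
    (hc : c < 0) : ∀ᶠ y in 𝓝[s \ {x}] x, slope f x y < 0 :=
  (hasDerivWithinAt_iff_tendsto_slope.1 h).eventually_lt_const hc

theorem slope_neg_iff_left {f : ℝ → ℝ} {x y : ℝ} (h : y < x) : slope f x y < 0 ↔ f x < f y := by
  rw [slope_comm]; exact slope_neg_iff_of_le h.le

/-- A differentiable function with a simple, decreasing zero is positive just before it and
negative just after it. -/
theorem exists_sign_change {g : ℝ → ℝ} {c z : ℝ} (h : HasDerivWithinAt g c (Icc 0 1) z)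
    (hz : z ∈ Ioo (0 : ℝ) 1) (h0 : g z = 0) (hc : c < 0) :
    ∃ δ > 0, (∀ t ∈ Ioo (z - δ) z, 0 < g t) ∧ ∀ t ∈ Ioo z (z + δ), g t < 0 := by
  have h' : HasDerivWithinAt g c univ z :=
    (h.hasDerivAt (Icc_mem_nhds hz.1 hz.2)).hasDerivWithinAt
  have h1 := eventually_slope_neg h' hc
  rw [eventually_nhdsWithin_iff, Metric.eventually_nhds_iff] at h1
  obtain ⟨δ, hδ, h2⟩ := h1
  refine ⟨δ, hδ, fun t ht => ?_, fun t ht => ?_⟩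
  · have := h2 (y := t) (by rw [Real.dist_eq, abs_lt]; constructor <;> linarith [ht.1, ht.2])
      ⟨trivial, ht.2.ne⟩
    rwa [slope_neg_iff_left ht.2, h0] at this
  · have := h2 (y := t) (by rw [Real.dist_eq, abs_lt]; constructor <;> linarith [ht.1, ht.2])
      ⟨trivial, ht.1.ne'⟩
    rwa [slope_neg_iff_of_le ht.1.le, h0] at this

section
variable {g g' : ℝ → ℝ} (hg : ∀ t ∈ Icc (0 : ℝ) 1, HasDerivWithinAt g (g' t) (Icc 0 1) t)
  (hs : ∀ t ∈ Icc (0 : ℝ) 1, g t = 0 → g' t ≠ 0)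

include hg hs

/-- An accumulation point of zeros in the compact interval would itself be a zero, but a nonzero
derivative there excludes other zeros nearby. -/
theorem finite_zeros : {t | t ∈ Icc (0 : ℝ) 1 ∧ g t = 0}.Finite := by
  by_contra hinf
  obtain ⟨z, hz, hacc⟩ := Set.Infinite.exists_accPt_of_subset_isCompact hinf isCompact_Icc
    (fun t ht => ht.1)
  have hgc : ContinuousOn g (Icc 0 1) := fun t ht => (hg t ht).continuousWithinAt
  have hcl : IsClosed {t | t ∈ Icc (0 : ℝ) 1 ∧ g t = 0} :=
    hgc.preimage_isClosed_of_isClosed isClosed_Icc isClosed_singleton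
  have hz0 : g z = 0 := (hcl.closure_subset_iff.2 subset_rfl
    (mem_closure_iff_clusterPt.2 hacc.clusterPt)).2
  have hne := (hg z hz).eventually_ne (c := 0) (hs z hz hz0)
  rw [accPt_iff_frequently_nhdsNE] at hacc
  rw [sdiff_eq, inter_comm, nhdsWithin_inter', eventually_inf_principal] at hne
  obtain ⟨t, ht, ht'⟩ := (hacc.and_eventually hne).exists
  exact ht' ht.1 ht.2

/-- Take the last point of `[a, b]` at which `g ≥ 0`. It is a zero with `g < 0` after it, so the
derivative cannot be positive, and simplicity makes it negative. -/
theorem exists_decreasing_zero {a b : ℝ} (ha : 0 ≤ a) (hb : b ≤ 1) (hab : a < b) (hga : 0 < g a)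
    (hgb : g b < 0) : ∃ z ∈ Ioo a b, g z = 0 ∧ g' z < 0 := by
  have hsub : Icc a b ⊆ Icc 0 1 := Icc_subset_Icc ha hb
  have hgc : ContinuousOn g (Icc a b) := fun t ht => (hg t (hsub ht)).continuousWithinAt.mono hsub
  have hK : IsCompact {t | t ∈ Icc a b ∧ 0 ≤ g t} :=
    isCompact_Icc.of_isClosed_subset (hgc.preimage_isClosed_of_isClosed isClosed_Icc isClosed_Ici)
      (fun t ht => ht.1)
  obtain ⟨z, ⟨hz, hz0⟩, hmax⟩ := hK.exists_isGreatest ⟨a, ⟨le_rfl, hab.le⟩, hga.le⟩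
  have hzb : z < b := lt_of_le_of_ne hz.2 (by rintro rfl; linarith)
  have hneg : ∀ t ∈ Ioc z b, g t < 0 := by
    intro t ht
    by_contra! h
    exact absurd (hmax ⟨⟨hz.1.trans ht.1.le, ht.2⟩, h⟩) (not_le.2 ht.1)
  have hgz : g z = 0 := by
    obtain ⟨t, ht, ht0⟩ := intermediate_value_Icc' hzb.le (hgc.mono (Icc_subset_Icc_left hz.1))
      ⟨hgb.le, hz0⟩
    rcases ht.1.eq_or_lt with h | h
    · rw [h]; exact ht0
    · exact absurd ht0 (hneg t ⟨h, ht.2⟩).ne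
  have hza : a < z := lt_of_le_of_ne hz.1 (by rintro rfl; linarith)
  refine ⟨z, ⟨hza, hzb⟩, hgz, lt_of_le_of_ne ?_ (hs z (hsub hz) hgz)⟩
  by_contra! hpos
  have h2 : HasDerivWithinAt (fun t => - g t) (-(g' z)) (Ioo z b) z :=
    ((hg z (hsub hz)).mono (fun t ht => hsub ⟨hz.1.trans ht.1.le, ht.2.le⟩)).neg
  have h3 := eventually_slope_neg h2 (by linarith)
  rw [sdiff_singleton_eq_self (by simp), nhdsWithin_Ioo_eq_nhdsGT hzb] at h3
  obtain ⟨t, ht, ht'⟩ := (h3.and (Ioo_mem_nhdsGT hzb)).exists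
  rw [slope_neg_iff_of_le ht'.1.le] at ht
  linarith [hneg t ⟨ht'.1, ht'.2.le⟩]

end

/-- The number of dyadic intervals of level `n` on which `g` goes from positive to negative. -/
def dyadicDrops (g : ℝ → ℝ) (n : ℕ) : ℕ :=
  ∑ k ∈ Finset.range (2 ^ n),
    {x : ℝ × ℝ | 0 < x.1 ∧ x.2 < 0}.indicator 1 (g (k / 2 ^ n), g ((k + 1 : ℕ) / 2 ^ n))

/-- If `g` drops across an interval and its midpoint value is nonzero, then `g` drops across one of
the two halves. This gives the monotonicity needed for monotone convergence. -/
theorem dyadicDrops_mono {g : ℝ → ℝ} (hd : ∀ n k : ℕ, k ≤ 2 ^ n → g (k / 2 ^ n) ≠ 0) :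
    Monotone (dyadicDrops g) := by
  refine monotone_nat_of_le_succ fun n => ?_
  have key : ∀ (f : ℕ → ℕ) (m : ℕ), ∑ k ∈ Finset.range (2 * m), f k =
      ∑ k ∈ Finset.range m, (f (2 * k) + f (2 * k + 1)) := by
    intro f m
    induction m with
    | zero => simp
    | succ m ih =>
      rw [Finset.sum_range_succ, ← ih, mul_add, mul_one, Finset.sum_range_succ,
        Finset.sum_range_succ, add_assoc]
  rw [dyadicDrops, dyadicDrops, pow_succ', key]
  refine Finset.sum_le_sum fun k hk => ?_
  rw [Finset.mem_range] at hk
  have e1 : ((2 * k : ℕ) : ℝ) / 2 ^ (n + 1) = k / 2 ^ n := by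
    rw [pow_succ]; push_cast; field_simp
  have e2 : ((2 * k + 1 + 1 : ℕ) : ℝ) / 2 ^ (n + 1) = (k + 1 : ℕ) / 2 ^ n := by
    rw [pow_succ]; push_cast; field_simp; ring
  have hm := hd (n + 1) (2 * k + 1) (by rw [pow_succ]; omega)
  rw [e1, e2]
  generalize g (k / 2 ^ n) = x
  generalize g ((k + 1 : ℕ) / 2 ^ n) = y
  generalize g ((2 * k + 1 : ℕ) / 2 ^ (n + 1)) = m at hm
  simp only [indicator_apply, mem_ofPred_eq, Pi.one_apply]
  rcases lt_or_gt_of_ne hm with h | h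
  · by_cases hx : 0 < x <;> by_cases hy : y < 0 <;> simp [hx, hy, h, h.not_gt]
  · by_cases hx : 0 < x <;> by_cases hy : y < 0 <;> simp [hx, hy, h, h.not_gt]

theorem dyadicDrops_eq_card (g : ℝ → ℝ) (n : ℕ) : dyadicDrops g n =
    ((Finset.range (2 ^ n)).filter fun k : ℕ =>
      0 < g (k / 2 ^ n) ∧ g ((k + 1 : ℕ) / 2 ^ n) < 0).card := by
  rw [Finset.card_filter, dyadicDrops]
  refine Finset.sum_congr rfl fun k _ => ?_
  simp [indicator_apply]

theorem floor_two_pow_mul {z : ℝ} {n k : ℕ} (h : z ∈ Ico ((k : ℝ) / 2 ^ n) ((k + 1 : ℕ) / 2 ^ n)) :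
    ⌊2 ^ n * z⌋₊ = k := by
  have hp : (0 : ℝ) < 2 ^ n := by positivity
  rw [Nat.floor_eq_iff (mul_nonneg hp.le ((div_nonneg k.cast_nonneg hp.le).trans h.1))]
  have h1 := (div_le_iff₀ hp).1 h.1
  have h2 := (lt_div_iff₀ hp).1 h.2
  push_cast at h2
  constructor <;> linarith

theorem mem_Ico_floor {z : ℝ} (hz : 0 ≤ z) (n : ℕ) :
    z ∈ Ico ((⌊2 ^ n * z⌋₊ : ℝ) / 2 ^ n) ((⌊2 ^ n * z⌋₊ + 1 : ℕ) / 2 ^ n) := by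
  have hp : (0 : ℝ) < 2 ^ n := by positivity
  have h1 := Nat.floor_le (mul_nonneg hp.le hz)
  have h2 := Nat.lt_floor_add_one (2 ^ n * z)
  constructor
  · rw [div_le_iff₀ hp]; linarith
  · rw [lt_div_iff₀ hp]; push_cast; linarith

/-- The points at which a function with simple zeros changes from positive to negative are counted
by the dyadic intervals of a sufficiently high level. -/
theorem eventually_dyadicDrops_eq {g g' : ℝ → ℝ}
    (hg : ∀ t ∈ Icc (0 : ℝ) 1, HasDerivWithinAt g (g' t) (Icc 0 1) t)
    (hs : ∀ t ∈ Icc (0 : ℝ) 1, g t = 0 → g' t ≠ 0)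
    (hd : ∀ n k : ℕ, k ≤ 2 ^ n → g (k / 2 ^ n) ≠ 0) :
    ∀ᶠ n in atTop, dyadicDrops g n = {t | t ∈ Ioo (0 : ℝ) 1 ∧ g t = 0 ∧ g' t < 0}.ncard := by
  have hfin : {t | t ∈ Ioo (0 : ℝ) 1 ∧ g t = 0 ∧ g' t < 0}.Finite :=
    (finite_zeros hg hs).subset fun t ht => ⟨Ioo_subset_Icc_self ht.1, ht.2.1⟩
  rw [ncard_eq_toFinset_card _ hfin]
  -- For large `n` the mesh `(1 / 2) ^ n` is smaller than the radius of the sign pattern around each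
  -- of the finitely many zeros.
  have hloc : ∀ z ∈ {t | t ∈ Ioo (0 : ℝ) 1 ∧ g t = 0 ∧ g' t < 0}, ∀ᶠ n : ℕ in atTop,
      (∀ t ∈ Ioo (z - (1 / 2) ^ n) z, 0 < g t) ∧ ∀ t ∈ Ioo z (z + (1 / 2) ^ n), g t < 0 := by
    rintro z ⟨hz, hz0, hz'⟩
    obtain ⟨δ, hδ, h1, h2⟩ := exists_sign_change (hg z (Ioo_subset_Icc_self hz)) hz hz0 hz'
    filter_upwards [(tendsto_pow_atTop_nhds_zero_of_lt_one (r := (1 / 2 : ℝ)) (by norm_num)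
      (by norm_num)).eventually_lt_const hδ] with n hn
    exact ⟨fun t ht => h1 t ⟨by linarith [ht.1], ht.2⟩, fun t ht => h2 t ⟨ht.1, by linarith [ht.2]⟩⟩
  filter_upwards [hfin.eventually_all.2 hloc] with n hn
  have hp : (0 : ℝ) < 2 ^ n := by positivity
  have hwidth : ∀ k : ℕ, ((k + 1 : ℕ) : ℝ) / 2 ^ n = k / 2 ^ n + (1 / 2) ^ n := by
    intro k; rw [one_div, inv_pow]; push_cast; field_simp
  rw [dyadicDrops_eq_card]
  have hIoo : ∀ z ∈ {t | t ∈ Ioo (0 : ℝ) 1 ∧ g t = 0 ∧ g' t < 0},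
      ⌊2 ^ n * z⌋₊ < 2 ^ n ∧
      z ∈ Ioo ((⌊2 ^ n * z⌋₊ : ℝ) / 2 ^ n) ((⌊2 ^ n * z⌋₊ + 1 : ℕ) / 2 ^ n) := by
    rintro z ⟨hz, hz0, hz'⟩
    have h := mem_Ico_floor hz.1.le n
    have hlt : ⌊2 ^ n * z⌋₊ < 2 ^ n := by
      rw [Nat.floor_lt (mul_nonneg hp.le hz.1.le)]
      push_cast
      nlinarith [hz.2]
    refine ⟨hlt, lt_of_le_of_ne h.1 ?_, h.2⟩
    intro heq
    apply hd n _ hlt.le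
    rw [heq]; exact hz0
  apply le_antisymm
  · have hex : ∀ k ∈ (Finset.range (2 ^ n)).filter fun k : ℕ =>
      0 < g (k / 2 ^ n) ∧ g ((k + 1 : ℕ) / 2 ^ n) < 0,
      ∃ z ∈ Ioo ((k : ℝ) / 2 ^ n) ((k + 1 : ℕ) / 2 ^ n), g z = 0 ∧ g' z < 0 := by
      intro k hk
      rw [Finset.mem_filter, Finset.mem_range] at hk
      refine exists_decreasing_zero hg hs (by positivity) ?_ ?_ hk.2.1 hk.2.2
      · rw [div_le_one hp]; exact_mod_cast hk.1
      · rw [hwidth]; linarith [show (0 : ℝ) < (1 / 2) ^ n by positivity]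
    choose! z hz using hex
    refine Finset.card_le_card_of_injOn z (fun k hk => ?_) (fun k hk l hl h => ?_)
    · have hk' := hk
      rw [Finset.mem_coe, Finset.mem_filter, Finset.mem_range] at hk'
      obtain ⟨h1, h2, h3⟩ := hz k hk
      simp only [Finite.coe_toFinset, mem_ofPred_eq]
      refine ⟨⟨lt_of_le_of_lt (by positivity) h1.1, h1.2.trans_le ?_⟩, h2, h3⟩
      rw [div_le_one hp]; exact_mod_cast hk'.1
    · rw [← floor_two_pow_mul (Ioo_subset_Ico_self (hz k hk).1), h,
        floor_two_pow_mul (Ioo_subset_Ico_self (hz l hl).1)]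
  -- Conversely, the interval around a decreasing zero has both ends within one mesh of it, so `g`
  -- drops across it. Two such zeros cannot share an interval, as `g < 0` on the mesh-long stretch
  -- after the first.
  · refine Finset.card_le_card_of_injOn (fun z => ⌊2 ^ n * z⌋₊) (fun z hz => ?_) ?_
    · rw [Finite.coe_toFinset] at hz
      obtain ⟨h1, h2⟩ := hIoo z hz
      have h3 := hwidth ⌊2 ^ n * z⌋₊
      rw [Finset.mem_coe, Finset.mem_filter, Finset.mem_range]
      refine ⟨h1, (hn z hz).1 _ ⟨?_, h2.1⟩, (hn z hz).2 _ ⟨h2.2, ?_⟩⟩ <;> linarith [h2.1, h2.2]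
    · rw [Finite.coe_toFinset]
      have hlt : ∀ z ∈ {t | t ∈ Ioo (0 : ℝ) 1 ∧ g t = 0 ∧ g' t < 0},
          ∀ w ∈ {t | t ∈ Ioo (0 : ℝ) 1 ∧ g t = 0 ∧ g' t < 0},
          ⌊2 ^ n * z⌋₊ = ⌊2 ^ n * w⌋₊ → ¬ z < w := by
        intro z hz w hw h hzw
        have h1 := (hIoo z hz).2
        have h2 := (hIoo w hw).2
        rw [← h] at h2
        have h3 := hwidth ⌊2 ^ n * z⌋₊
        have := (hn z hz).2 w ⟨hzw, by linarith [h1.1, h2.2]⟩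
        rw [hw.2.1] at this
        exact lt_irrefl _ this
      intro z hz w hw h
      exact le_antisymm (not_lt.1 (hlt w hw z hz h.symm)) (not_lt.1 (hlt z hz w hw h))

/-! ### Length of a spherical curve by inscribed polygons -/

/-- The chord of an arc of angle `θ` is `2 sin (θ / 2)`; the cubic Taylor bound controls the
difference by a multiple of `θ ^ 3`, and Jordan's inequality turns `θ` back into the chord. -/
theorem abs_angle_sub_norm_sub_le {a b : R3} (ha : ‖a‖ = 1) (hb : ‖b‖ = 1) :
    |InnerProductGeometry.angle a b - ‖a - b‖| ≤ ‖a - b‖ ^ 3 := by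
  set θ := InnerProductGeometry.angle a b with hθ
  have h0 : 0 ≤ θ := InnerProductGeometry.angle_nonneg a b
  have hπ : θ ≤ Real.pi := InnerProductGeometry.angle_le_pi a b
  have hcos : Real.cos θ = inner ℝ a b := by
    rw [hθ, InnerProductGeometry.cos_angle, ha, hb]; simp
  have hs0 : 0 ≤ Real.sin (θ / 2) := Real.sin_nonneg_of_nonneg_of_le_pi (by linarith) (by linarith)
  have hchord : ‖a - b‖ = 2 * Real.sin (θ / 2) := by
    rw [← sq_eq_sq₀ (norm_nonneg _) (by linarith), norm_sub_sq_real, ha, hb, ← hcos]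
    have h2 : Real.cos θ = 2 * Real.cos (θ / 2) ^ 2 - 1 := by
      rw [← Real.cos_two_mul]; congr 1; ring
    rw [h2]
    linear_combination -4 * Real.sin_sq_add_cos_sq (θ / 2)
  have hle : Real.sin (θ / 2) ≤ θ / 2 := Real.sin_le (by linarith)
  have hjordan : θ / 2 ≤ 2 * Real.sin (θ / 2) := by
    have h1 := Real.mul_le_sin (x := θ / 2) (by linarith) (by linarith)
    have h2 : (1 / 2 : ℝ) ≤ 2 / Real.pi := by
      rw [le_div_iff₀ Real.pi_pos]; linarith [Real.pi_le_four]
    nlinarith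
  have hcube : θ / 2 - (θ / 2) ^ 3 / 6 ≤ Real.sin (θ / 2) := by
    rcases h0.eq_or_lt with h | h
    · rw [← h]; simp
    · exact (Real.sin_gt_sub_cube (by linarith)).le
  have h3 : (θ / 2) ^ 3 ≤ (2 * Real.sin (θ / 2)) ^ 3 := pow_le_pow_left₀ (by linarith) hjordan 3
  rw [hchord, abs_of_nonneg (by linarith)]
  have h4 : 0 ≤ (2 * Real.sin (θ / 2)) ^ 3 := by positivity
  linarith

section
variable {T T' : ℝ → R3} (hT : ∀ t ∈ Icc (0 : ℝ) 1, HasDerivWithinAt T (T' t) (Icc 0 1) t)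
  (hT' : ContinuousOn T' (Icc 0 1)) (h1 : ∀ t ∈ Icc (0 : ℝ) 1, ‖T t‖ = 1)

include hT hT' h1

/-- On short intervals the angle between the end points of a spherical curve is close to the
length of the curve, relative to the length of the interval. -/
theorem exists_abs_angle_sub_integral_le {ε : ℝ} (hε : 0 < ε) :
    ∃ δ > 0, ∀ s t, 0 ≤ s → s ≤ t → t ≤ 1 → t - s < δ →
      |InnerProductGeometry.angle (T s) (T t) - ∫ x in s..t, ‖T' x‖| ≤ ε * (t - s) := by
  obtain ⟨M, hM⟩ := isCompact_Icc.exists_bound_of_continuousOn hT'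
  have hM0 : 0 ≤ M := (norm_nonneg _).trans (hM 0 (by simp))
  have huc := isCompact_Icc.uniformContinuousOn_of_continuous hT'
  rw [Metric.uniformContinuousOn_iff] at huc
  obtain ⟨δ₁, hδ₁, huc⟩ := huc (ε / 3) (by linarith)
  -- Three errors of `ε / 3 * (t - s)` are allowed: angle against chord, chord against `(t - s) *
  -- ‖T' s‖`, and that against the integral. `δ₁` handles the last two; the other bounds make `(M *
  -- (t - s)) ^ 3` small enough for the first.
  refine ⟨min δ₁ (min 1 (ε / 3 / (M ^ 3 + 1))), by positivity, fun s t hs hst ht hδ => ?_⟩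
  rw [lt_min_iff, lt_min_iff, lt_div_iff₀ (by positivity)] at hδ
  obtain ⟨d1, d2, d3⟩ := hδ
  have hsub : Icc s t ⊆ Icc 0 1 := Icc_subset_Icc hs ht
  have hsI : s ∈ Icc s t := ⟨le_rfl, hst⟩
  have htI : t ∈ Icc s t := ⟨hst, le_rfl⟩
  have hclose : ∀ x ∈ Icc s t, ‖T' x - T' s‖ ≤ ε / 3 := by
    intro x hx
    rw [← dist_eq_norm]
    refine (huc x (hsub hx) s (hsub hsI) ?_).le
    rw [Real.dist_eq, abs_of_nonneg (by linarith [hx.1])]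
    linarith [hx.2]
  have hchord : ‖T s - T t‖ ≤ M * (t - s) := by
    have := (convex_Icc s t).norm_image_sub_le_of_norm_hasDerivWithin_le
      (fun x hx => (hT x (hsub hx)).mono hsub) (fun x hx => hM x (hsub hx)) hsI htI
    rwa [norm_sub_rev, Real.norm_of_nonneg (by linarith : 0 ≤ t - s)] at this
  have hlin : ‖T t - T s - (t - s) • T' s‖ ≤ ε / 3 * (t - s) := by
    have := (convex_Icc s t).norm_image_sub_le_of_norm_hasDerivWithin_le
      (f := fun x => T x - x • T' s) (f' := fun x => T' x - (1 : ℝ) • T' s)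
      (fun x hx => ((hT x (hsub hx)).mono hsub).sub ((hasDerivWithinAt_id x _).smul_const _))
      (fun x hx => by rw [one_smul]; exact hclose x hx) hsI htI
    rw [Real.norm_of_nonneg (by linarith : 0 ≤ t - s)] at this
    rw [show T t - T s - (t - s) • T' s = T t - t • T' s - (T s - s • T' s) by
      rw [sub_smul]; abel]
    exact this
  have hint : |(∫ x in s..t, ‖T' x‖) - (t - s) * ‖T' s‖| ≤ ε / 3 * (t - s) := by
    have hi : IntervalIntegrable (fun x => ‖T' x‖) volume s t :=
      (hT'.norm.mono hsub).intervalIntegrable_of_Icc hst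
    have e : (∫ x in s..t, ‖T' x‖) - (t - s) * ‖T' s‖ = ∫ x in s..t, (‖T' x‖ - ‖T' s‖) := by
      rw [intervalIntegral.integral_sub hi (by simp)]
      simp
    have := intervalIntegral.norm_integral_le_of_norm_le_const (a := s) (b := t)
      (f := fun x => ‖T' x‖ - ‖T' s‖) (C := ε / 3) (fun x hx => by
        rw [uIoc_of_le hst] at hx
        exact (abs_norm_sub_norm_le _ _).trans (hclose x ⟨hx.1.le, hx.2⟩))
    rwa [abs_of_nonneg (by linarith : 0 ≤ t - s), ← e] at this
  have hnorm : |‖T s - T t‖ - (t - s) * ‖T' s‖| ≤ ε / 3 * (t - s) := by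
    have := abs_norm_sub_norm_le (T t - T s) ((t - s) • T' s)
    rw [norm_smul, Real.norm_of_nonneg (by linarith : 0 ≤ t - s), norm_sub_rev] at this
    exact this.trans hlin
  have hang := abs_angle_sub_norm_sub_le (h1 s (hsub hsI)) (h1 t (hsub htI))
  have hcube : ‖T s - T t‖ ^ 3 ≤ ε / 3 * (t - s) := by
    have h2 : 0 ≤ t - s := by linarith
    have h3 : 0 ≤ M ^ 3 := by positivity
    calc ‖T s - T t‖ ^ 3 ≤ (M * (t - s)) ^ 3 := pow_le_pow_left₀ (norm_nonneg _) hchord 3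
      _ = (M ^ 3 * (t - s)) * (t - s) * (t - s) := by ring
      _ ≤ (M ^ 3 * (t - s)) * 1 * (t - s) := by gcongr
      _ ≤ ε / 3 * (t - s) := by
        rw [mul_one]
        refine mul_le_mul_of_nonneg_right ?_ h2
        linarith
  rw [abs_le] at *
  constructor <;> linarith [hang.1, hang.2, hnorm.1, hnorm.2, hint.1, hint.2]

/-- The length of a spherical curve as a limit of the lengths of inscribed polygons. -/
theorem tendsto_sum_angle :
    Tendsto (fun n : ℕ => ∑ k ∈ Finset.range (2 ^ n),
      InnerProductGeometry.angle (T ((k : ℝ) / 2 ^ n)) (T ((k + 1 : ℕ) / 2 ^ n))) atTop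
      (𝓝 (∫ x in (0 : ℝ)..1, ‖T' x‖)) := by
  rw [Metric.tendsto_nhds]
  intro ε hε
  obtain ⟨δ, hδ, H⟩ := exists_abs_angle_sub_integral_le hT hT' h1 (half_pos hε)
  filter_upwards [(tendsto_pow_atTop_nhds_zero_of_lt_one (r := (1 / 2 : ℝ)) (by norm_num)
      (by norm_num)).eventually_lt_const hδ] with n hn
  have hp : (0 : ℝ) < 2 ^ n := by positivity
  have hwidth : ∀ k : ℕ, ((k + 1 : ℕ) : ℝ) / 2 ^ n - k / 2 ^ n = (1 / 2) ^ n := by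
    intro k; rw [one_div, inv_pow]; push_cast; field_simp; ring
  have hw0 : (0 : ℝ) < (1 / 2) ^ n := by positivity
  have hle1 : ∀ k < 2 ^ n, ((k + 1 : ℕ) : ℝ) / 2 ^ n ≤ 1 := by
    intro k hk
    rw [div_le_one hp]; exact_mod_cast hk
  have hsum : ∫ x in (0 : ℝ)..1, ‖T' x‖ = ∑ k ∈ Finset.range (2 ^ n),
      ∫ x in ((k : ℝ) / 2 ^ n)..((k + 1 : ℕ) / 2 ^ n), ‖T' x‖ := by
    rw [intervalIntegral.sum_integral_adjacent_intervals (a := fun k : ℕ => (k : ℝ) / 2 ^ n)]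
    · congr 1
      · simp
      · push_cast; field_simp
    · intro k hk
      have := hwidth k
      refine ContinuousOn.intervalIntegrable_of_Icc (by linarith) (hT'.norm.mono ?_)
      exact Icc_subset_Icc (by positivity) (hle1 k hk)
  rw [Real.dist_eq, hsum, ← Finset.sum_sub_distrib]
  refine (Finset.abs_sum_le_sum_abs _ _).trans_lt ?_
  calc _ ≤ ∑ k ∈ Finset.range (2 ^ n), ε / 2 * (1 / 2) ^ n := by
        refine Finset.sum_le_sum fun k hk => ?_
        rw [Finset.mem_range] at hk
        have := hwidth k
        rw [← this]
        exact H _ _ (by positivity) (by linarith) (hle1 k hk) (by linarith)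
    _ = ε / 2 := by
        rw [Finset.sum_const, Finset.card_range, nsmul_eq_mul, one_div, inv_pow]
        push_cast
        field_simp
    _ < ε := by linarith

end

end SpatialGraph

open SpatialGraph

namespace PiecewiseC2Graph

/-! ### Local extrema at the vertices -/

/-- For an involution without fixed points, each unordered pair `s(h, σ h)` comes from exactly two
elements, `h` and `σ h`. It converts counts of points over a vertex into counts of half-edges. -/
theorem two_mul_ncard_pairs {H : Type*} [Fintype H] {σ : H → H} (hσ : ∀ h, σ (σ h) = h)
    (hne : ∀ h, σ h ≠ h) {p : H → Prop} [DecidablePred p] (hp : ∀ h, p h → p (σ h)) :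
    2 * Set.ncard {x : Sym2 H | ∃ h, p h ∧ x = s(h, σ h)} = (Finset.univ.filter p).card := by
  classical
  have e : {x : Sym2 H | ∃ h, p h ∧ x = s(h, σ h)} =
      ((Finset.univ.filter p).image fun h => s(h, σ h) : Finset (Sym2 H)) := by
    ext x
    simp [eq_comm]
  rw [e, ncard_coe_finset, Finset.card_eq_sum_card_image (fun h => s(h, σ h)),
    Finset.sum_const_nat (m := 2), mul_comm]
  intro x hx
  obtain ⟨h, hh, rfl⟩ := Finset.mem_image.1 hx
  rw [Finset.mem_filter] at hh
  rw [← Finset.card_pair (hne h).symm]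
  congr 1
  ext k
  simp only [Finset.mem_filter, Finset.mem_univ, true_and, Finset.mem_insert, Finset.mem_singleton,
    Sym2.eq_iff]
  constructor
  · rintro ⟨-, h1 | h1⟩
    · exact Or.inl h1.1
    · exact Or.inr h1.1
  · rintro (rfl | rfl)
    · exact ⟨hh.2, Or.inl ⟨rfl, rfl⟩⟩
    · exact ⟨hp _ hh.2, Or.inr ⟨rfl, hσ h⟩⟩

variable {V E : Type*} (Γ : PiecewiseC2Graph V E)

theorem hasDerivWithinAt_arc (a : E) {t : ℝ} (ht : t ∈ Icc (0 : ℝ) 1) :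
    HasDerivWithinAt (Γ.arc a) (Γ.velocity a t) (Icc 0 1) t :=
  (((Γ.contDiffOn a).differentiableOn (by norm_num)) t ht).hasDerivWithinAt

theorem velocity_ne_zero (a : E) {t : ℝ} (ht : t ∈ Icc (0 : ℝ) 1) : Γ.velocity a t ≠ 0 :=
  Γ.regular a t ht

theorem norm_unitTangent (a : E) {t : ℝ} (ht : t ∈ Icc (0 : ℝ) 1) : ‖Γ.unitTangent a t‖ = 1 := by
  rw [unitTangent, norm_smul, norm_inv, norm_norm,
    inv_mul_cancel₀ (norm_ne_zero_iff.2 (Γ.velocity_ne_zero a ht))]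

theorem tangentAt_ne_zero (h : E × Bool) : Γ.tangentAt h ≠ 0 := by
  rw [← norm_ne_zero_iff]
  unfold tangentAt
  split_ifs
  · rw [norm_neg, norm_unitTangent _ _ (by simp)]; exact one_ne_zero
  · rw [norm_unitTangent _ _ (by simp)]; exact one_ne_zero

theorem halfEdgePath_zero (h : E × Bool) : Γ.halfEdgePath h 0 = Γ.pos (Γ.vertexOf h) := by
  obtain ⟨a, b⟩ := h
  cases b
  · simp [halfEdgePath, vertexOf, Γ.arc_zero]
  · simp [halfEdgePath, vertexOf, Γ.arc_one]

theorem exists_hasDerivWithinAt_halfEdgePath (h : E × Bool) : ∃ r > (0 : ℝ),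
    HasDerivWithinAt (Γ.halfEdgePath h) (r • Γ.tangentAt h) (Icc 0 1) 0 := by
  obtain ⟨a, b⟩ := h
  cases b
  · have h0 : (0 : ℝ) ∈ Icc (0 : ℝ) 1 := by simp
    have hp := norm_pos_iff.2 (Γ.velocity_ne_zero a h0)
    refine ⟨_, hp, ?_⟩
    have hpath : Γ.halfEdgePath (a, false) = Γ.arc a := by ext1 t; simp [halfEdgePath]
    have htan : ‖Γ.velocity a 0‖ • Γ.tangentAt (a, false) = Γ.velocity a 0 := by
      simp [tangentAt, unitTangent, smul_smul, hp.ne']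
    rw [hpath, htan]
    exact Γ.hasDerivWithinAt_arc a h0
  · have h0 : (1 : ℝ) ∈ Icc (0 : ℝ) 1 := by simp
    have hp := norm_pos_iff.2 (Γ.velocity_ne_zero a h0)
    refine ⟨_, hp, ?_⟩
    have h1 := Γ.hasDerivWithinAt_arc a h0
    have h2 : HasDerivWithinAt (fun t : ℝ => 1 - t) (-1) (Icc 0 1) 0 := by
      simpa using (hasDerivWithinAt_id (0 : ℝ) (Icc 0 1)).const_sub 1
    have h3 := HasDerivWithinAt.scomp_of_eq (0 : ℝ) h1 h2
      (fun t ht => ⟨by linarith [ht.2], by linarith [ht.1]⟩) (by norm_num)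
    have hpath : Γ.halfEdgePath (a, true) = Γ.arc a ∘ fun t => 1 - t := by
      ext1 t; simp [halfEdgePath]
    have htan : ‖Γ.velocity a 1‖ • Γ.tangentAt (a, true) = (-1 : ℝ) • Γ.velocity a 1 := by
      simp [tangentAt, unitTangent, smul_smul, hp.ne']
    rw [hpath, htan]
    exact h3

/-- Along a half-edge on whose tangent the height is negative, the height starts by decreasing. -/
theorem exists_height_halfEdgePath_lt (h : E × Bool) {e : S2}
    (he : inner ℝ (e : R3) (Γ.tangentAt h) < 0) : ∃ δ > 0, ∀ t ∈ Ioo 0 δ,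
      height e (Γ.halfEdgePath h t) < height e (Γ.pos (Γ.vertexOf h)) := by
  obtain ⟨r, hr, hd⟩ := Γ.exists_hasDerivWithinAt_halfEdgePath h
  have h1 : HasDerivWithinAt (fun t => height e (Γ.halfEdgePath h t))
      (inner ℝ (e : R3) (r • Γ.tangentAt h)) (Icc 0 1) 0 :=
    (innerSL ℝ (e : R3)).hasFDerivAt.comp_hasDerivWithinAt (0 : ℝ) hd
  rw [inner_smul_right] at h1
  have h2 := eventually_slope_neg (h1.mono (Ioo_subset_Icc_self)) (mul_neg_iff_neg hr |>.2 he)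
  rw [sdiff_singleton_eq_self (by simp), nhdsWithin_Ioo_eq_nhdsGT one_pos] at h2
  obtain ⟨δ, hδ, hsub⟩ := mem_nhdsGT_iff_exists_Ioo_subset.1 h2
  refine ⟨δ, hδ, fun t ht => ?_⟩
  have : slope (fun t => height e (Γ.halfEdgePath h t)) 0 t < 0 := hsub ht
  rw [← Γ.halfEdgePath_zero h]
  exact (slope_neg_iff_of_le ht.1.le).1 this

theorem height_neg (e : S2) (x : R3) : height (-e) x = - height e x := by
  simp [height]

variable {Γ}

/-- With no tangent orthogonal to `e`, first derivatives decide whether the height lies above or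
below its vertex value at the start of each half-edge. Rising half-edges are handled by passing to
`-e`. -/
theorem Parameterization.isLocalMax_pathThrough_iff (P : Γ.Parameterization) {e : S2}
    (he : ∀ h, inner ℝ (e : R3) (Γ.tangentAt h) ≠ 0) (h : E × Bool) :
    IsLocalMax (fun t => height e (P.pathThrough h t)) 0 ↔
      inner ℝ (e : R3) (Γ.tangentAt h) < 0 ∧ inner ℝ (e : R3) (Γ.tangentAt (P.next h)) < 0 := by
  have hv := P.vertexOf_next h
  have h0 : P.pathThrough h 0 = Γ.pos (Γ.vertexOf h) := by
    simp [pathThrough, halfEdgePath_zero]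
  have hpos : ∀ t, 0 < t → P.pathThrough h t = Γ.halfEdgePath h t := by
    intro t ht; simp [pathThrough, ht.le]
  have hneg : ∀ t, 0 < t → P.pathThrough h (-t) = Γ.halfEdgePath (P.next h) t := by
    intro t ht; simp [pathThrough, ht]
  have hrise : ∀ k, ¬ inner ℝ (e : R3) (Γ.tangentAt k) < 0 → ∃ δ > 0, ∀ t ∈ Ioo 0 δ,
      height e (Γ.pos (Γ.vertexOf k)) < height e (Γ.halfEdgePath k t) := by
    intro k hk
    have : inner ℝ ((-e : S2) : R3) (Γ.tangentAt k) < 0 := by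
      have := lt_of_le_of_ne (not_lt.1 hk) (he k).symm
      simpa using this
    obtain ⟨δ, hδ, hlt⟩ := Γ.exists_height_halfEdgePath_lt k this
    refine ⟨δ, hδ, fun t ht => ?_⟩
    have := hlt t ht
    rw [height_neg, height_neg] at this
    linarith
  constructor
  · intro hmax
    rw [IsLocalMax, IsMaxFilter, Metric.eventually_nhds_iff] at hmax
    obtain ⟨η, hη, hmax⟩ := hmax
    constructor
    · by_contra hk
      obtain ⟨δ, hδ, hlt⟩ := hrise _ hk
      have hm : 0 < min η δ / 2 := by positivity
      have hmη := min_le_left η δ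
      have hmδ := min_le_right η δ
      have h1 := hmax (y := min η δ / 2) (by rw [Real.dist_eq, sub_zero, abs_of_pos hm]; linarith)
      have h2 := hlt (min η δ / 2) ⟨hm, by linarith⟩
      rw [h0, hpos _ hm] at h1
      linarith
    · by_contra hk
      obtain ⟨δ, hδ, hlt⟩ := hrise _ hk
      have hm : 0 < min η δ / 2 := by positivity
      have hmη := min_le_left η δ
      have hmδ := min_le_right η δ
      have h1 := hmax (y := -(min η δ / 2))
        (by rw [Real.dist_eq, sub_zero, abs_neg, abs_of_pos hm]; linarith)
      have h2 := hlt (min η δ / 2) ⟨hm, by linarith⟩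
      rw [h0, hneg _ hm] at h1
      rw [hv] at h2
      linarith
  · rintro ⟨h1, h2⟩
    obtain ⟨δ₁, hδ₁, hlt₁⟩ := Γ.exists_height_halfEdgePath_lt h h1
    obtain ⟨δ₂, hδ₂, hlt₂⟩ := Γ.exists_height_halfEdgePath_lt (P.next h) h2
    rw [IsLocalMax, IsMaxFilter, Metric.eventually_nhds_iff]
    refine ⟨min δ₁ δ₂, lt_min hδ₁ hδ₂, fun t ht => ?_⟩
    rw [Real.dist_eq, sub_zero, lt_min_iff] at ht
    rcases lt_trichotomy t 0 with h3 | h3 | h3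
    · have := hlt₂ (-t) ⟨by linarith, by rw [abs_of_neg h3] at ht; exact ht.2⟩
      rw [← hneg (-t) (by linarith), neg_neg, hv, ← h0] at this
      exact this.le
    · rw [h3]
    · have := hlt₁ t ⟨h3, by rw [abs_of_pos h3] at ht; exact ht.1⟩
      rw [← hpos t h3, ← h0] at this
      exact this.le

theorem Parameterization.isLocalMin_pathThrough_iff (P : Γ.Parameterization) {e : S2}
    (he : ∀ h, inner ℝ (e : R3) (Γ.tangentAt h) ≠ 0) (h : E × Bool) :
    IsLocalMin (fun t => height e (P.pathThrough h t)) 0 ↔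
      0 < inner ℝ (e : R3) (Γ.tangentAt h) ∧ 0 < inner ℝ (e : R3) (Γ.tangentAt (P.next h)) := by
  have h1 := P.isLocalMax_pathThrough_iff (e := -e) (fun h => by simpa using he h) h
  simp only [height_neg, coe_neg_sphere, inner_neg_left, Left.neg_neg_iff] at h1
  rw [← h1]
  exact ⟨fun h => h.neg, fun h => by simpa using h.neg⟩

open Classical in
/-- The sum of the signs `χ` over the half-edges at a vertex. -/
def chiSum [Fintype E] (Γ : PiecewiseC2Graph V E) (v : V) (e : S2) : ℝ :=
  ∑ h : E × Bool with Γ.vertexOf h = v, chi (Γ.tangentAt h) e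

-- The sum `χ h + χ (next h)` is `2` at a local maximum, `-2` at a local minimum and `0` otherwise.
-- Summed over the half-edges at `v`, each `χ` occurs twice, since `next` permutes them, and each
-- glued pair is also met twice.
open Classical in
theorem Parameterization.two_mul_lmax_sub_lmin [Fintype E] (P : Γ.Parameterization) {e : S2}
    (he : ∀ h, inner ℝ (e : R3) (Γ.tangentAt h) ≠ 0) (v : V) :
    2 * ((P.vertexLmax e v : ℝ) - P.vertexLmin e v) = Γ.chiSum v e := by
  have hmax := two_mul_ncard_pairs P.next_next P.next_ne (p := fun h => Γ.vertexOf h = v ∧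
    inner ℝ (e : R3) (Γ.tangentAt h) < 0 ∧ inner ℝ (e : R3) (Γ.tangentAt (P.next h)) < 0)
    (fun h ⟨h1, h2, h3⟩ => ⟨(P.vertexOf_next h).trans h1, h3, by rwa [P.next_next]⟩)
  have hmin := two_mul_ncard_pairs P.next_next P.next_ne (p := fun h => Γ.vertexOf h = v ∧
    0 < inner ℝ (e : R3) (Γ.tangentAt h) ∧ 0 < inner ℝ (e : R3) (Γ.tangentAt (P.next h)))
    (fun h ⟨h1, h2, h3⟩ => ⟨(P.vertexOf_next h).trans h1, h3, by rwa [P.next_next]⟩)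
  have emax : P.vertexLmax e v = Set.ncard {x : Sym2 (E × Bool) | ∃ h, (Γ.vertexOf h = v ∧
      inner ℝ (e : R3) (Γ.tangentAt h) < 0 ∧ inner ℝ (e : R3) (Γ.tangentAt (P.next h)) < 0) ∧
      x = s(h, P.next h)} := by
    rw [vertexLmax]
    congr 1
    ext x
    simp only [mem_ofPred_eq, P.isLocalMax_pathThrough_iff he]
    exact exists_congr fun h => by tauto
  have emin : P.vertexLmin e v = Set.ncard {x : Sym2 (E × Bool) | ∃ h, (Γ.vertexOf h = v ∧
      0 < inner ℝ (e : R3) (Γ.tangentAt h) ∧ 0 < inner ℝ (e : R3) (Γ.tangentAt (P.next h))) ∧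
      x = s(h, P.next h)} := by
    rw [vertexLmin]
    congr 1
    ext x
    simp only [mem_ofPred_eq, P.isLocalMin_pathThrough_iff he]
    exact exists_congr fun h => by tauto
  rw [← emax] at hmax
  rw [← emin] at hmin
  have hσ : ∑ h : E × Bool, (if Γ.vertexOf h = v then chi (Γ.tangentAt (P.next h)) e else 0) =
      ∑ h : E × Bool, if Γ.vertexOf h = v then chi (Γ.tangentAt h) e else 0 := by
    have hinv : Function.Involutive P.next := P.next_next
    refine Fintype.sum_equiv (hinv.toPerm P.next) _ _ fun h => ?_
    rw [Function.Involutive.coe_toPerm, P.vertexOf_next]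
  have hpt : ∀ h, (if Γ.vertexOf h = v then chi (Γ.tangentAt h) e else 0) +
      (if Γ.vertexOf h = v then chi (Γ.tangentAt (P.next h)) e else 0) =
      2 * (if Γ.vertexOf h = v ∧ inner ℝ (e : R3) (Γ.tangentAt h) < 0 ∧
        inner ℝ (e : R3) (Γ.tangentAt (P.next h)) < 0 then (1 : ℝ) else 0) -
      2 * (if Γ.vertexOf h = v ∧ 0 < inner ℝ (e : R3) (Γ.tangentAt h) ∧
        0 < inner ℝ (e : R3) (Γ.tangentAt (P.next h)) then (1 : ℝ) else 0) := by
    intro h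
    by_cases hv : Γ.vertexOf h = v
    · rcases lt_or_gt_of_ne (he h) with h1 | h1 <;>
        rcases lt_or_gt_of_ne (he (P.next h)) with h2 | h2 <;>
        simp [chi, hv, h1, h2, h1.le, h2.le, h1.not_gt, h2.not_gt, h1.not_ge, h2.not_ge] <;>
        norm_num
    · simp [hv]
  have hsum := Finset.sum_congr (s₁ := Finset.univ) rfl fun h _ => hpt h
  rw [Finset.sum_add_distrib, hσ, Finset.sum_sub_distrib, ← Finset.mul_sum, ← Finset.mul_sum,
    Finset.sum_boole, Finset.sum_boole, ← hmax, ← hmin, ← Finset.sum_filter] at hsum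
  rw [chiSum]
  push_cast at hsum
  linarith

theorem chiSum_double [Fintype E] (Γ : PiecewiseC2Graph V E) (v : V) (e : S2) :
    Γ.double.chiSum v e = 2 * Γ.chiSum v e := by
  classical
  simp only [chiSum, Finset.sum_filter, Fintype.sum_prod_type, Fintype.sum_bool, Finset.mul_sum]
  refine Finset.sum_congr rfl fun a _ => ?_
  have h1 : ∀ b c, Γ.double.vertexOf ((a, c), b) = Γ.vertexOf (a, b) := fun _ _ => rfl
  have h2 : ∀ b c, Γ.double.tangentAt ((a, c), b) = Γ.tangentAt (a, b) := fun _ _ => rfl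
  simp only [h1, h2]
  ring

/-- `nlm` is a quarter of the sign sum of the double, hence half of that of `Γ`; in particular it
does not depend on the gluing `P`. -/
theorem max_vertexNlm_eq [Fintype E] (P : Γ.double.Parameterization) {e : S2}
    (he : ∀ h, inner ℝ (e : R3) (Γ.tangentAt h) ≠ 0) (v : V) :
    max (vertexNlm P e v) 0 = 1 / 2 * max (Γ.chiSum v e) 0 := by
  have h1 := P.two_mul_lmax_sub_lmin (e := e) (fun h => he (h.1.1, h.2)) v
  rw [chiSum_double] at h1
  have h2 : vertexNlm P e v = 1 / 2 * Γ.chiSum v e := by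
    rw [vertexNlm]; linarith
  rw [h2, mul_max_of_nonneg _ _ (by norm_num), mul_zero]

theorem measurable_chiSum [Fintype E] (v : V) : Measurable (Γ.chiSum v) := by
  unfold chiSum
  refine Finset.measurable_sum _ fun h _ => ?_
  unfold chi
  refine Measurable.ite ?_ measurable_const measurable_const
  exact (isClosed_le continuous_const (by fun_prop)).measurableSet

theorem integrable_max_chiSum [Fintype E] (v : V) :
    Integrable (fun e => max (Γ.chiSum v e) 0) area := by
  have : IsFiniteMeasure area := by unfold area; infer_instance
  refine Integrable.of_bound (((measurable_chiSum v).max measurable_const).aestronglyMeasurable)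
    (Fintype.card (E × Bool)) (ae_of_all _ fun e => ?_)
  rw [Real.norm_of_nonneg (le_max_right _ _)]
  refine max_le ?_ (Nat.cast_nonneg _)
  unfold chiSum
  refine (Finset.sum_le_card_nsmul _ _ 1 fun h _ => ?_).trans ?_
  · unfold chi; split_ifs <;> norm_num
  · rw [nsmul_eq_mul, mul_one]
    exact_mod_cast Finset.card_le_univ _

/-! ### Mean number of peaks along an edge -/

variable (Γ)

theorem contDiffOn_velocity (a : E) : ContDiffOn ℝ 1 (Γ.velocity a) (Icc 0 1) :=
  (Γ.contDiffOn a).derivWithin (uniqueDiffOn_Icc one_pos) (by norm_num)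

theorem contDiffOn_unitTangent (a : E) : ContDiffOn ℝ 1 (Γ.unitTangent a) (Icc 0 1) := by
  have h := Γ.contDiffOn_velocity a
  exact ((h.norm ℝ fun t ht => Γ.velocity_ne_zero a ht).inv
    fun t ht => norm_ne_zero_iff.2 (Γ.velocity_ne_zero a ht)).smul h

/-- The derivative of the velocity of an edge with respect to the parameter. -/
def acceleration (a : E) (t : ℝ) : R3 := derivWithin (Γ.velocity a) (Icc 0 1) t

theorem hasDerivWithinAt_velocity (a : E) {t : ℝ} (ht : t ∈ Icc (0 : ℝ) 1) :
    HasDerivWithinAt (Γ.velocity a) (Γ.acceleration a t) (Icc 0 1) t :=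
  (((Γ.contDiffOn_velocity a).differentiableOn (by norm_num)) t ht).hasDerivWithinAt

theorem continuousOn_acceleration (a : E) : ContinuousOn (Γ.acceleration a) (Icc 0 1) :=
  (Γ.contDiffOn_velocity a).continuousOn_derivWithin (uniqueDiffOn_Icc one_pos) le_rfl

/-- The speed factors cancel, so the total curvature is the length of the tangent indicatrix, to
which `tendsto_sum_angle` applies. -/
theorem edgeCurvature_eq (a : E) :
    Γ.edgeCurvature a = ∫ t in (0 : ℝ)..1, ‖derivWithin (Γ.unitTangent a) (Icc 0 1) t‖ := by
  refine intervalIntegral.integral_congr fun t ht => ?_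
  rw [uIcc_of_le zero_le_one] at ht
  have := norm_ne_zero_iff.2 (Γ.velocity_ne_zero a ht)
  simp only [curvatureVector, norm_smul, norm_inv, norm_norm]
  field_simp

/-- The parameters of the interior points of an edge at which the height has a nondegenerate local
maximum. -/
def heightPeaks (a : E) (e : S2) : Set ℝ :=
  {t | t ∈ Ioo (0 : ℝ) 1 ∧ inner ℝ (e : R3) (Γ.velocity a t) = 0 ∧
    inner ℝ (e : R3) (Γ.acceleration a t) < 0}

/-- The directions for which the height along an edge is a Morse function without critical points
at the dyadic parameters. -/
structure IsGeneric (a : E) (e : S2) : Prop where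
  simple : ∀ t ∈ Icc (0 : ℝ) 1, inner ℝ (e : R3) (Γ.velocity a t) = 0 →
    inner ℝ (e : R3) (Γ.acceleration a t) ≠ 0
  dyadic : ∀ n k : ℕ, k ≤ 2 ^ n → inner ℝ (e : R3) (Γ.velocity a (k / 2 ^ n)) ≠ 0

theorem dyadic_mem_Icc {n k : ℕ} (h : k ≤ 2 ^ n) : (k : ℝ) / 2 ^ n ∈ Icc (0 : ℝ) 1 := by
  refine ⟨by positivity, ?_⟩
  rw [div_le_one (by positivity)]
  exact_mod_cast h

theorem ae_isGeneric (a : E) : ∀ᵐ e ∂area, Γ.IsGeneric a e := by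
  have h1 := ae_simple_zeros isCompact_Icc (fun t ht => Γ.hasDerivWithinAt_velocity a ht)
    (Γ.continuousOn_acceleration a) (fun t ht => Γ.velocity_ne_zero a ht)
  have h2 : ∀ᵐ e : S2 ∂area, ∀ n k : ℕ, k ≤ 2 ^ n →
      inner ℝ (e : R3) (Γ.velocity a (k / 2 ^ n)) ≠ 0 := by
    rw [ae_all_iff]; intro n
    rw [ae_all_iff]; intro k
    by_cases hk : k ≤ 2 ^ n
    · filter_upwards [ae_inner_ne_zero (Γ.velocity_ne_zero a (dyadic_mem_Icc hk))] with e he _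
      exact he
    · exact ae_of_all _ fun e h => absurd h hk
  filter_upwards [h1, h2] with e he1 he2 using ⟨he1, he2⟩

theorem hasDerivWithinAt_inner_velocity (a : E) (e : S2) {t : ℝ} (ht : t ∈ Icc (0 : ℝ) 1) :
    HasDerivWithinAt (fun t => inner ℝ (e : R3) (Γ.velocity a t))
      (inner ℝ (e : R3) (Γ.acceleration a t)) (Icc 0 1) t :=
  (innerSL ℝ (e : R3)).hasFDerivAt.comp_hasDerivWithinAt t (Γ.hasDerivWithinAt_velocity a ht)

theorem angle_velocity (a : E) {s t : ℝ} (hs : s ∈ Icc (0 : ℝ) 1) (ht : t ∈ Icc (0 : ℝ) 1) :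
    InnerProductGeometry.angle (Γ.unitTangent a s) (Γ.unitTangent a t) =
      InnerProductGeometry.angle (Γ.velocity a s) (Γ.velocity a t) := by
  rw [unitTangent, unitTangent, InnerProductGeometry.angle_smul_left_of_pos _ _
    (inv_pos.2 (norm_pos_iff.2 (Γ.velocity_ne_zero a hs))),
    InnerProductGeometry.angle_smul_right_of_pos _ _
    (inv_pos.2 (norm_pos_iff.2 (Γ.velocity_ne_zero a ht)))]

/-- The number of sign changes of the slope of the height that are seen at dyadic level `n`. -/
def peakApprox (a : E) (n : ℕ) (e : S2) : ℕ :=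
  dyadicDrops (fun t => inner ℝ (e : R3) (Γ.velocity a t)) n

/-- Written through lunes, the sampled count is visibly measurable and its integral is a sum of lune
areas. -/
theorem peakApprox_eq (a : E) (n : ℕ) (e : S2) : (Γ.peakApprox a n e : ℝ≥0∞) =
    ∑ k ∈ Finset.range (2 ^ n), (lune (Γ.velocity a (k / 2 ^ n))
      (Γ.velocity a ((k + 1 : ℕ) / 2 ^ n))).indicator 1 e := by
  rw [peakApprox, dyadicDrops, Nat.cast_sum]
  refine Finset.sum_congr rfl fun k _ => ?_
  simp [indicator_apply, lune]

theorem measurable_peakApprox (a : E) (n : ℕ) :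
    Measurable fun e => (Γ.peakApprox a n e : ℝ≥0∞) := by
  simp_rw [peakApprox_eq]
  exact Finset.measurable_sum _ fun k _ => measurable_one.indicator (measurableSet_lune _ _)

theorem lintegral_peakApprox (a : E) (n : ℕ) : ∫⁻ e, Γ.peakApprox a n e ∂area =
    ENNReal.ofReal (2 * ∑ k ∈ Finset.range (2 ^ n), InnerProductGeometry.angle
      (Γ.unitTangent a (k / 2 ^ n)) (Γ.unitTangent a ((k + 1 : ℕ) / 2 ^ n))) := by
  simp_rw [peakApprox_eq]
  rw [lintegral_finsetSum _ fun k _ => measurable_one.indicator (measurableSet_lune _ _),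
    Finset.mul_sum, ENNReal.ofReal_sum_of_nonneg fun k _ =>
      mul_nonneg zero_le_two (InnerProductGeometry.angle_nonneg _ _)]
  refine Finset.sum_congr rfl fun k hk => ?_
  rw [Finset.mem_range] at hk
  rw [lintegral_indicator_one (measurableSet_lune _ _),
    area_lune (Γ.velocity_ne_zero a (dyadic_mem_Icc hk.le))
      (Γ.velocity_ne_zero a (dyadic_mem_Icc hk)),
    Γ.angle_velocity a (dyadic_mem_Icc hk.le) (dyadic_mem_Icc hk)]

variable {Γ} in
theorem IsGeneric.eventually_peakApprox_eq {a : E} {e : S2} (he : Γ.IsGeneric a e) :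
    ∀ᶠ n in atTop, Γ.peakApprox a n e = (Γ.heightPeaks a e).ncard :=
  eventually_dyadicDrops_eq (fun _ ht => Γ.hasDerivWithinAt_inner_velocity a e ht)
    he.simple he.dyadic

/-- The mean number of nondegenerate local maxima of the height along an edge is twice its total
curvature. -/
theorem lintegral_ncard_heightPeaks (a : E) :
    ∫⁻ e, (Γ.heightPeaks a e).ncard ∂area = ENNReal.ofReal (2 * Γ.edgeCurvature a) := by
  -- Monotone convergence; at each generic `e` the sequence of counts is eventually constant, equal
  -- to the number of peaks.
  have h1 : Tendsto (fun n => ∫⁻ e, (Γ.peakApprox a n e : ℝ≥0∞) ∂area) atTop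
      (𝓝 (∫⁻ e, (Γ.heightPeaks a e).ncard ∂area)) := by
    refine lintegral_tendsto_of_tendsto_of_monotone
      (fun n => (Γ.measurable_peakApprox a n).aemeasurable) ?_ ?_
    · filter_upwards [Γ.ae_isGeneric a] with e he
      exact fun m n hmn => Nat.cast_le.2 (dyadicDrops_mono he.dyadic hmn)
    · filter_upwards [Γ.ae_isGeneric a] with e he
      refine tendsto_const_nhds.congr' ?_
      filter_upwards [he.eventually_peakApprox_eq] with n hn
      rw [hn]
  have hT := Γ.contDiffOn_unitTangent a
  have h2 := tendsto_sum_angle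
    (fun t ht => ((hT.differentiableOn (by norm_num)) t ht).hasDerivWithinAt)
    (hT.continuousOn_derivWithin (uniqueDiffOn_Icc one_pos) le_rfl)
    (fun t ht => Γ.norm_unitTangent a ht)
  have h3 := ENNReal.tendsto_ofReal (h2.const_mul 2)
  rw [← edgeCurvature_eq] at h3
  simp_rw [lintegral_peakApprox] at h1
  exact tendsto_nhds_unique h1 h3

/-- Measurability is inherited from the dyadic counts, whose limit this is almost everywhere. -/
theorem aemeasurable_ncard_heightPeaks (a : E) :
    AEMeasurable (fun e => ((Γ.heightPeaks a e).ncard : ℝ)) area := by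
  refine aemeasurable_of_tendsto_metrizable_ae atTop
    (f := fun n e => (Γ.peakApprox a n e : ℝ)) (fun n => ?_) ?_
  · have := (Γ.measurable_peakApprox a n).ennreal_toReal
    simpa using this.aemeasurable
  · filter_upwards [Γ.ae_isGeneric a] with e he
    refine tendsto_const_nhds.congr' ?_
    filter_upwards [he.eventually_peakApprox_eq] with n hn
    rw [hn]

theorem edgeCurvature_nonneg (a : E) : 0 ≤ Γ.edgeCurvature a := by
  rw [edgeCurvature_eq]
  exact intervalIntegral.integral_nonneg zero_le_one fun t _ => norm_nonneg _

theorem integrable_ncard_heightPeaks (a : E) :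
    Integrable (fun e => ((Γ.heightPeaks a e).ncard : ℝ)) area := by
  refine ⟨(Γ.aemeasurable_ncard_heightPeaks a).aestronglyMeasurable, ?_⟩
  rw [hasFiniteIntegral_iff_ofReal (ae_of_all _ fun e => Nat.cast_nonneg _)]
  simp_rw [ENNReal.ofReal_natCast]
  rw [lintegral_ncard_heightPeaks]
  exact ENNReal.ofReal_lt_top

theorem integral_ncard_heightPeaks (a : E) :
    ∫ e, ((Γ.heightPeaks a e).ncard : ℝ) ∂area = 2 * Γ.edgeCurvature a := by
  rw [integral_eq_lintegral_of_nonneg_ae (ae_of_all _ fun e => Nat.cast_nonneg _)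
    (Γ.aemeasurable_ncard_heightPeaks a).aestronglyMeasurable]
  simp_rw [ENNReal.ofReal_natCast]
  rw [lintegral_ncard_heightPeaks,
    ENNReal.toReal_ofReal (mul_nonneg zero_le_two (Γ.edgeCurvature_nonneg a))]

/-! ### Interior critical points and the multiplicity -/

theorem hasDerivAt_height_arc (a : E) (e : S2) {t : ℝ} (ht : t ∈ Ioo (0 : ℝ) 1) :
    HasDerivAt (fun s => height e (Γ.arc a s)) (inner ℝ (e : R3) (Γ.velocity a t)) t :=
  (innerSL ℝ (e : R3)).hasFDerivAt.comp_hasDerivAt t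
    ((Γ.hasDerivWithinAt_arc a (Ioo_subset_Icc_self ht)).hasDerivAt (Icc_mem_nhds ht.1 ht.2))

theorem deriv_deriv_height_arc (a : E) (e : S2) {t : ℝ} (ht : t ∈ Ioo (0 : ℝ) 1) :
    deriv (deriv fun s => height e (Γ.arc a s)) t = inner ℝ (e : R3) (Γ.acceleration a t) := by
  have h1 : deriv (fun s => height e (Γ.arc a s)) =ᶠ[𝓝 t]
      fun s => inner ℝ (e : R3) (Γ.velocity a s) := by
    filter_upwards [Ioo_mem_nhds ht.1 ht.2] with s hs
    exact (Γ.hasDerivAt_height_arc a e hs).deriv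
  rw [h1.deriv_eq]
  exact ((Γ.hasDerivWithinAt_inner_velocity a e (Ioo_subset_Icc_self ht)).hasDerivAt
    (Icc_mem_nhds ht.1 ht.2)).deriv

/-- A function with both properties is locally constant. Non-strict extrema make this case possible,
and it must be excluded for the counts of maxima and minima not to cancel. -/
theorem deriv_deriv_eq_zero_of_isLocalMax_of_isLocalMin {f : ℝ → ℝ} {t : ℝ}
    (h1 : IsLocalMax f t) (h2 : IsLocalMin f t) : deriv (deriv f) t = 0 := by
  have h3 : f =ᶠ[𝓝 t] fun _ => f t := by
    filter_upwards [h1, h2] with s hs1 hs2 using le_antisymm hs1 hs2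
  have h4 : deriv f =ᶠ[𝓝 t] fun _ => 0 := by
    filter_upwards [h3.deriv] with s hs
    rw [hs, deriv_const]
  rw [h4.deriv_eq, deriv_const]

-- The two copies of the edge carry the same height function, so a nondegenerate maximum contributes
-- `(2 - 0) / 2 = 1` and a nondegenerate minimum `-1`, which the positive part removes.
open Classical in
variable {Γ} in
theorem IsGeneric.max_interiorNlm_eq {a : E} {e : S2} (he : Γ.IsGeneric a e) {t : ℝ}
    (ht : t ∈ Ioo (0 : ℝ) 1) (h0 : inner ℝ (e : R3) (Γ.velocity a t) = 0) :
    max (Γ.interiorNlm e a t) 0 = if t ∈ Γ.heightPeaks a e then 1 else 0 := by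
  set f := fun s => height e (Γ.arc a s) with hf
  have hd : deriv f t = 0 := (Γ.hasDerivAt_height_arc a e ht).deriv.trans h0
  have hdd : deriv (deriv f) t = _ := Γ.deriv_deriv_height_arc a e ht
  have hc : ContinuousAt f t := (Γ.hasDerivAt_height_arc a e ht).continuousAt
  have hne := he.simple t (Ioo_subset_Icc_self ht) h0
  have hnot : IsLocalMax f t → ¬ IsLocalMin f t := fun h1 h2 => hne
    (hdd.symm.trans (deriv_deriv_eq_zero_of_isLocalMax_of_isLocalMin h1 h2))
  have hmax : Γ.interiorLmax e a t = if IsLocalMax f t then 2 else 0 := by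
    change Set.ncard {c : Bool | IsLocalMax f t} = _
    split_ifs with h <;> simp [h]
  have hmin : Γ.interiorLmin e a t = if IsLocalMin f t then 2 else 0 := by
    change Set.ncard {c : Bool | IsLocalMin f t} = _
    split_ifs with h <;> simp [h]
  have hpk : t ∈ Γ.heightPeaks a e ↔ inner ℝ (e : R3) (Γ.acceleration a t) < 0 :=
    ⟨fun h => h.2.2, fun h => ⟨ht, h0, h⟩⟩
  rw [interiorNlm, hmax, hmin, hpk]
  rcases lt_or_gt_of_ne hne with h | h
  · have h1 : IsLocalMax f t := isLocalMax_of_deriv_deriv_neg (hdd ▸ h) hd hc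
    simp [h1, hnot h1, h]
  · have h1 : IsLocalMin f t := isLocalMin_of_deriv_deriv_pos (hdd ▸ h) hd hc
    have h2 : ¬ IsLocalMax f t := fun h2 => hnot h2 h1
    simp [h1, h2, h.not_gt]

theorem mem_criticalPoints_iff {e : S2} {q : E × ℝ} : q ∈ Γ.criticalPoints e ↔
    q.2 ∈ Ioo (0 : ℝ) 1 ∧ inner ℝ (e : R3) (Γ.velocity q.1 q.2) = 0 := by
  refine and_congr_right fun h => ?_
  rw [(Γ.hasDerivAt_height_arc q.1 e h).deriv]

theorem finite_criticalPoints [Finite E] {e : S2} (he : ∀ a, Γ.IsGeneric a e) :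
    (Γ.criticalPoints e).Finite := by
  have h : Γ.criticalPoints e ⊆ ⋃ a : E, Prod.mk a '' {t | t ∈ Icc (0 : ℝ) 1 ∧
      inner ℝ (e : R3) (Γ.velocity a t) = 0} := by
    intro q hq
    rw [mem_criticalPoints_iff] at hq
    exact mem_iUnion.2 ⟨q.1, q.2, ⟨Ioo_subset_Icc_self hq.1, hq.2⟩, rfl⟩
  refine (finite_iUnion fun a => ?_).subset h
  exact (finite_zeros (fun _ ht => Γ.hasDerivWithinAt_inner_velocity a e ht) (he a).simple).image _

theorem finsum_max_interiorNlm [Fintype E] {e : S2} (he : ∀ a, Γ.IsGeneric a e) :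
    ∑ᶠ q ∈ Γ.criticalPoints e, max (Γ.interiorNlm e q.1 q.2) 0 =
      ∑ a, ((Γ.heightPeaks a e).ncard : ℝ) := by
  classical
  have hfin := Γ.finite_criticalPoints he
  rw [finsum_mem_eq_finite_toFinset_sum _ hfin, Finset.sum_congr rfl (g := fun q : E × ℝ =>
    if q.2 ∈ Γ.heightPeaks q.1 e then (1 : ℝ) else 0) fun q hq => by
      rw [Finite.mem_toFinset, mem_criticalPoints_iff] at hq
      exact (he q.1).max_interiorNlm_eq hq.1 hq.2, Finset.sum_boole,
    -- The peaks among the critical points are counted edge by edge, as the fibres of the first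
    -- projection.
    Finset.card_eq_sum_card_fiberwise (t := Finset.univ) (f := Prod.fst)
      (fun _ _ => Finset.mem_coe.2 (Finset.mem_univ _)), Nat.cast_sum]
  refine Finset.sum_congr rfl fun a _ => ?_
  rw [← ncard_coe_finset,
    ← ncard_image_of_injective (Γ.heightPeaks a e) (Prod.mk_right_injective a)]
  refine congrArg (fun s : Set (E × ℝ) => (s.ncard : ℝ)) ?_
  ext ⟨b, t⟩
  simp only [Finset.coe_filter, Finset.mem_filter, Finite.mem_toFinset, mem_ofPred_eq,
    mem_criticalPoints_iff, mem_image, Prod.mk.injEq]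
  constructor
  · rintro ⟨⟨-, h⟩, rfl⟩
    exact ⟨t, h, rfl, rfl⟩
  · rintro ⟨s, h, rfl, rfl⟩
    exact ⟨⟨⟨h.1, h.2.1⟩, h⟩, rfl⟩

theorem multiplicity_ae_eq [Fintype V] [Fintype E] (P : Γ.double.Parameterization) :
    multiplicity P =ᵐ[area] fun e => ∑ v, 1 / 2 * max (Γ.chiSum v e) 0 +
      ∑ a, ((Γ.heightPeaks a e).ncard : ℝ) := by
  filter_upwards [ae_all_iff.2 Γ.ae_isGeneric,
    ae_all_iff.2 fun h => ae_inner_ne_zero (Γ.tangentAt_ne_zero h)] with e he1 he2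
  rw [multiplicity, Γ.finsum_max_interiorNlm he1]
  congr 1
  exact Finset.sum_congr rfl fun v _ => max_vertexNlm_eq P he2 v

end PiecewiseC2Graph

end

/-! ### The integral formula -/

open SpatialGraph PiecewiseC2Graph in
theorem mainTheorem2 {V E : Type*} [Fintype V] [Fintype E] (Γ : PiecewiseC2Graph V E)
    (P : Γ.double.Parameterization) :
    (∀ᵐ e ∂SpatialGraph.area, (Γ.criticalPoints e).Finite) ∧
    Integrable (PiecewiseC2Graph.multiplicity P) SpatialGraph.area ∧
    Γ.NTC = 1 / 2 * ∫ e : SpatialGraph.S2, PiecewiseC2Graph.multiplicity P e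
      ∂SpatialGraph.area := by
  have hV : ∀ v ∈ Finset.univ, Integrable (fun e => 1 / 2 * max (Γ.chiSum v e) 0) area :=
    fun v _ => (integrable_max_chiSum v).const_mul _
  have hE : ∀ a ∈ Finset.univ, Integrable (fun e => ((Γ.heightPeaks a e).ncard : ℝ)) area :=
    fun a _ => Γ.integrable_ncard_heightPeaks a
  have hV' := integrable_finsetSum _ hV
  have hE' := integrable_finsetSum _ hE
  refine ⟨?_, (hV'.add hE').congr (Γ.multiplicity_ae_eq P).symm, ?_⟩
  · filter_upwards [ae_all_iff.2 Γ.ae_isGeneric] with e he using Γ.finite_criticalPoints he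
  -- The constants match: `1 / 2 * (1 / 2) = 1 / 4` at the vertices, and `1 / 2 * 2 = 1` on the
  -- edges.
  · rw [integral_congr_ae (Γ.multiplicity_ae_eq P), integral_add hV' hE',
      integral_finsetSum _ hV, integral_finsetSum _ hE, mul_add, Finset.mul_sum, Finset.mul_sum,
      NTC]
    congr 1
    · refine Finset.sum_congr rfl fun v _ => ?_
      rw [integral_const_mul, ntc]
      simp only [chiSum]
      ring
    · refine Finset.sum_congr rfl fun a _ => ?_
      rw [integral_ncard_heightPeaks]
      ring
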